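/- Consider $N\ge 1$ sources. Source $j$ generates updates according to a Poisson process of rate $\lambda_j>0$; the $N$ processes are independent, and $\lambda=\sum_{j=1}^N\lambda_j$. All updates share one server without buffer, initially empty at time $0$: an arriving update (of any source) is served at once, and an update still in service at that moment is discarded. Service times are i.i.d., independent of the arrivals, with an arbitrary law on $[0,\infty)$ whose Laplace transform is $L_S(s)=\mathbb E[e^{-sS}]$ (equal to $\int_0^\infty e^{-sx}f_S(x)\,dx$ if $S$ has a density $f_S$); the system is thus the multi-source M/G/1/1 bufferless preemptive system. Fix a source $i$. Let $t_{i,k}$ and $t'_{i,k}$ $(k\ge1)$ be the arrival and departure moments of the $k$-th successfully (i.e. completely) served update of source $i$, with $t_{i,0}=t'_{i,0}=0$. Let $Y_{i,k}=t'_{i,k}-t'_{i,k-1}$ be the inter-departure times, and let the age of information (AoI) be $\Delta_i(t)=t-t_{i,n_i(t)}$ with $n_i(t)=\max\{k: t'_{i,k}\le t\}$. Then there is a measurable function $f_{\Delta_i}\ge 0$ on $\mathbb R$, vanishing on $(-\infty,0)$, that is the inverse unilateral Laplace transform $$f_{\Delta_i}=L^{-1}\!\left[\frac{\lambda_iL_S(\lambda+s)}{\lambda_iL_S(\lambda+s)+s}\right],$$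 i.e. it is, up to a.e. equality, the only function vanishing on $(-\infty,0)$ with $\int_0^\infty e^{-sx}f_{\Delta_i}(x)\,dx=\frac{\lambda_iL_S(\lambda+s)}{\lambda_iL_S(\lambda+s)+s}$ (absolutely convergent) for all complex $s$ with $\operatorname{Re}s>0$, and such that: 1. For every threshold $w_i>0$, the AoI violation probability is $P_i^{\mathrm A}(w_i)=1-\int_0^{w_i}f_{\Delta_i}(x)\,dx$. That is, this number is almost surely the limit as $t\to\infty$ of the fraction of $[0,t]$ during which $\Delta_i>w_i$, and it is also $\lim_{t\to\infty}\Pr\{\Delta_i(t)>w_i\}$. 2. $f_{\Delta_i}$ is the probability density of the stationary AoI: the probability law $\rho$ with density $f_{\Delta_i}$ satisfies, for every $w\in\mathbb R$, that $\rho((w,\infty))$ is almost surely the long-run fraction of time during which $\Delta_i>w$, and is $\lim_{t\to\infty}\Pr\{\Delta_i(t)>w\}$. 3. Every inter-departure time $Y_{i,k}$, $k\ge1$, has density $f_{\Delta_i}$ as well; hence the stationary AoI has the same distribution as the inter-departure time $Y_i$. -/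

import Mathlib

open MeasureTheory ProbabilityTheory Filter Topology Set

noncomputable section

namespace MG11

/-- Laplace(-Stieltjes) transform `s ↦ 𝔼[exp (-s S)]` of a law `σ` carried by `[0, ∞)`.
If `σ` has a density, this is the unilateral Laplace transform of that density. -/
def laplace (σ : Measure ℝ) (s : ℂ) : ℂ := ∫ x, Complex.exp (-s * (x : ℂ)) ∂σ

/-- `f` is an inverse (unilateral) Laplace transform of `F`: it vanishes on the negative half-line,
and `∫₀^∞ exp (-s x) f x dx` converges absolutely to `F s` on the half-plane `0 < re s`. -/
def IsInverseLaplace (F : ℂ → ℂ) (f : ℝ → ℝ) : Prop :=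
  (∀ x, x < 0 → f x = 0) ∧
  ∀ s : ℂ, 0 < s.re →
    IntegrableOn (fun x : ℝ => Complex.exp (-s * (x : ℂ)) * (f x : ℂ)) (Ioi 0) ∧
    ∫ x in Ioi (0 : ℝ), Complex.exp (-s * (x : ℂ)) * (f x : ℂ) = F s

/-- The random input of the `N`-source system, started empty at time `0`. `X i n` is the time
between updates `n - 1` and `n` of source `i` (between time `0` and update `0` if `n = 0`), so the
updates of source `i` form a Poisson process of rate `rate i`; `S i n` is the service time required
by update `n` of source `i`, with law `σ`. All these variables are independent. -/
structure IsInput {Ω : Type*} [MeasurableSpace Ω] (P : Measure Ω) {N : ℕ} (rate : Fin N → ℝ)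
    (σ : Measure ℝ) (X S : Fin N → ℕ → Ω → ℝ) : Prop where
  measurable_X : ∀ i n, Measurable (X i n)
  measurable_S : ∀ i n, Measurable (S i n)
  law_X : ∀ i n, P.map (X i n) = expMeasure (rate i)
  law_S : ∀ i n, P.map (S i n) = σ
  indep : iIndepFun (Sum.elim (fun p : Fin N × ℕ => X p.1 p.2) (fun p : Fin N × ℕ => S p.1 p.2)) P

section Dynamics

variable {Ω : Type*} {N : ℕ} (X S : Fin N → ℕ → Ω → ℝ)

/-- Time at which update `n` of source `i` (successful or not) arrives. -/
def arrival (i : Fin N) (n : ℕ) (ω : Ω) : ℝ := ∑ m ∈ Finset.range (n + 1), X i m ω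

/-- Update `n` of source `i` is successfully received: its service starts on arrival, and no update
of any source arrives (and preempts it) while it is in service. -/
def Received (i : Fin N) (ω : Ω) (n : ℕ) : Prop :=
  ∀ (j : Fin N) (m : ℕ),
    ¬ (arrival X i n ω < arrival X j m ω ∧ arrival X j m ω < arrival X i n ω + S i n ω)

/-- Arrival moment of the `k`-th successfully received update of source `i`, for `k ≥ 1`;
by convention `0` for `k = 0`. -/
def recvArrival (i : Fin N) (ω : Ω) : ℕ → ℝ
  | 0 => 0
  | k + 1 => arrival X i (Nat.nth (Received X S i ω) k) ω

/-- Departure moment of the `k`-th successfully received update of source `i`, for `k ≥ 1`;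
by convention `0` for `k = 0`. -/
def departure (i : Fin N) (ω : Ω) : ℕ → ℝ
  | 0 => 0
  | k + 1 => arrival X i (Nat.nth (Received X S i ω) k) ω + S i (Nat.nth (Received X S i ω) k) ω

/-- The inter-departure time of source `i` between its `k`-th and `(k+1)`-th successfully received
updates (between time `0` and the first one if `k = 0`). -/
def interDeparture (i : Fin N) (k : ℕ) (ω : Ω) : ℝ :=
  departure X S i ω (k + 1) - departure X S i ω k

/-- Index `max {k | departure k ≤ t}` of the last update of source `i` received by time `t`. -/
def lastIndex (i : Fin N) (t : ℝ) (ω : Ω) : ℕ := sSup {k : ℕ | departure X S i ω k ≤ t}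

/-- Age of information of source `i` at time `t`: the time elapsed since the arrival moment of the
most recently received update. -/
def aoi (i : Fin N) (t : ℝ) (ω : Ω) : ℝ := t - recvArrival X S i ω (lastIndex X S i t ω)

end Dynamics

section LongRun

variable {Ω : Type*} [MeasurableSpace Ω]

/-- `p` is the violation probability of the age process `Δ` for the threshold `w`: almost surely
`p` is the long-run fraction of time during which the age exceeds `w`, and `p` is also the
steady-state probability `lim_{t → ∞} Pr (Δ t > w)`. -/
def IsViolationProbability (P : Measure Ω) (Δ : ℝ → Ω → ℝ) (w p : ℝ) : Prop :=
  (∀ᵐ ω ∂P, Tendsto (fun t : ℝ => volume.real {u : ℝ | u ∈ Icc 0 t ∧ w < Δ u ω} / t)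
    atTop (𝓝 p)) ∧
  Tendsto (fun t : ℝ => P.real {ω | w < Δ t ω}) atTop (𝓝 p)

/-- `ρ` is the stationary (long-run) distribution of the age process `Δ`. -/
def IsStationaryLaw (P : Measure Ω) (Δ : ℝ → Ω → ℝ) (ρ : Measure ℝ) : Prop :=
  IsProbabilityMeasure ρ ∧ ∀ w : ℝ, IsViolationProbability P Δ w (ρ.real (Ioi w))

end LongRun

end MG11

end

namespace MG11

open scoped ENNReal

/-! ### Exponential laws: memorylessness, tilting, transform. -/

section

/-! Write Λ for the total rate, D for the first departure of source i and L_S for the transform of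
σ. The input is carried to its canonical space, families of gaps and marks with law `dataLaw`
(`IsInput.map_eq_dataLaw`), where everything becomes a functional of the path.

By memorylessness, the earliest point comes after an Exp(Λ) time x, belongs to source j with
probability rate j / Λ, carries a mark s of law σ, and is followed by a fresh copy of the system
delayed by x (`dataLaw_eq_sum`). If this point is not a received update of source i, then D is x
plus the first departure of the copy. If it comes from source i, it is received when no point falls
in the next s time units; this has probability exp (-Λ s), leaves a fresh copy delayed by s more,
and gives D = x + s. For φ = 𝔼 exp (-z D), this first-step analysis reads z φ = rate i · L_S(Λ + z)
(1 - φ), which is the claimed transform (`integral_eq_of_firstStep`,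
`integral_cexp_interDepartureLaw`). The same identity at z = 0 shows that some update of source i is
almost surely received, and that consecutive inter-departure times have the same law
(`map_interDeparture_succ`).

For the age, the point is that for t > w one has Δ(t) > w exactly when no update of source i both
arrives and departs within [t - w, t] (`Regular.lt_aoi_iff`). The system is stationary in time
(`dataLaw_shift`), so this event has the probability of its analogue for [0, w], which is D > w
(`Regular.departure_one_le_iff`). Hence Pr(Δ(t) > w) already equals Pr(D > w) for every t > w. For
time averages, the violation time in a block of length w is determined by a window of length 2w;
every second block gives an i.i.d. sequence (`dataLaw_inter_shift`), and the strong law applies to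
the even and to the odd blocks.

Finally D has a density because it is an exponential time plus something independent of it
(`interDepartureLaw_absolutelyContinuous`), and the transform on the line re s = 1 determines that
density by Fourier injectivity (`IsInverseLaplace.ae_eq`). -/

theorem lintegral_expMeasure {a : ℝ} {f : ℝ → ℝ≥0∞} (hf : Measurable f) :
    ∫⁻ x, f x ∂expMeasure a = ∫⁻ x in Ici 0, ENNReal.ofReal (a * Real.exp (-(a * x))) * f x := by
  have hm : Measurable (gammaPDF 1 a) := (measurable_gammaPDFReal 1 a).ennreal_ofReal
  rw [expMeasure, gammaMeasure, lintegral_withDensity_eq_lintegral_mul _ hm hf,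
    ← lintegral_indicator measurableSet_Ici]
  refine lintegral_congr fun x => ?_
  change exponentialPDF a x * f x = _
  rw [exponentialPDF_eq]
  by_cases hx : 0 ≤ x
  · rw [indicator_of_mem (show x ∈ Ici 0 from hx), if_pos hx]
  · rw [indicator_of_notMem (show x ∉ Ici 0 from hx), if_neg hx]; simp

theorem expMeasure_absolutelyContinuous (a : ℝ) : expMeasure a ≪ volume :=
  withDensity_absolutelyContinuous _ _

theorem ae_expMeasure_pos (a : ℝ) : ∀ᵐ x ∂expMeasure a, 0 < x := by
  rw [ae_iff, ← lintegral_indicator_one (by measurability), lintegral_expMeasure (by measurability),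
    lintegral_eq_zero_iff (by measurability)]
  have : ∀ᵐ x : ℝ, x ≠ 0 := by simp [ae_iff]
  filter_upwards [ae_restrict_mem measurableSet_Ici, ae_restrict_of_ae this] with x hx hx0
  have : 0 < x := lt_of_le_of_ne hx hx0.symm
  simp [this]

/-- Memorylessness of the exponential law. -/
theorem setLIntegral_expMeasure_Ici {a r : ℝ} (hr : 0 ≤ r) {f : ℝ → ℝ≥0∞} (hf : Measurable f) :
    ∫⁻ x in Ici r, f x ∂expMeasure a =
      ENNReal.ofReal (Real.exp (-(a * r))) * ∫⁻ x, f (x + r) ∂expMeasure a := by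
  rw [← lintegral_indicator measurableSet_Ici,
    lintegral_expMeasure (hf.indicator measurableSet_Ici), lintegral_expMeasure (by fun_prop),
    ← lintegral_const_mul _ (by fun_prop), ← lintegral_indicator measurableSet_Ici,
    ← lintegral_indicator measurableSet_Ici]
  rw [← lintegral_add_right_eq_self _ r]
  refine lintegral_congr fun x => ?_
  by_cases hx : 0 ≤ x
  · rw [indicator_of_mem (show x + r ∈ Ici 0 by simp; positivity),
      indicator_of_mem (show x + r ∈ Ici r by simp [hx]), indicator_of_mem (show x ∈ Ici 0 from hx),
      ← mul_assoc, ← ENNReal.ofReal_mul (by positivity),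
      show a * Real.exp (-(a * (x + r))) = Real.exp (-(a * r)) * (a * Real.exp (-(a * x))) by
        rw [show -(a * (x + r)) = -(a * r) + -(a * x) by ring, Real.exp_add]; ring]
  · have h1 : x ∉ Ici (0 : ℝ) := hx
    have h2 : x + r ∉ Ici r := by simpa using hx
    rw [indicator_of_notMem h1]
    by_cases h3 : x + r ∈ Ici (0 : ℝ)
    · rw [indicator_of_mem h3, indicator_of_notMem h2, mul_zero]
    · rw [indicator_of_notMem h3]

theorem expMeasure_Ici {a r : ℝ} (ha : 0 < a) (hr : 0 ≤ r) :
    expMeasure a (Ici r) = ENNReal.ofReal (Real.exp (-(a * r))) := by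
  have := isProbabilityMeasure_expMeasure ha
  simpa using setLIntegral_expMeasure_Ici (a := a) hr (f := fun _ => 1) measurable_const

/-- Tilting an exponential law exponentially. -/
theorem lintegral_exp_mul_expMeasure {a b : ℝ} (ha : 0 < a) (hb : 0 ≤ b) {f : ℝ → ℝ≥0∞}
    (hf : Measurable f) :
    ∫⁻ x, ENNReal.ofReal (Real.exp (-(b * x))) * f x ∂expMeasure a =
      ENNReal.ofReal (a / (a + b)) * ∫⁻ x, f x ∂expMeasure (a + b) := by
  rw [lintegral_expMeasure (by fun_prop), lintegral_expMeasure hf,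
    ← lintegral_const_mul _ (by fun_prop)]
  refine lintegral_congr fun x => ?_
  rw [← mul_assoc, ← mul_assoc, ← ENNReal.ofReal_mul (by positivity),
    ← ENNReal.ofReal_mul (by positivity)]
  congr 2
  rw [show -((a + b) * x) = -(a * x) + -(b * x) by ring, Real.exp_add]
  field_simp

theorem integral_cexp_expMeasure {a : ℝ} (ha : 0 < a) {z : ℂ} (hz : 0 ≤ z.re) :
    ∫ x, Complex.exp (-z * (x : ℂ)) ∂expMeasure a = a / (a + z) := by
  have hm : Measurable (gammaPDFReal 1 a) := measurable_gammaPDFReal 1 a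
  have hre : ((-((a : ℂ) + z)).re) < 0 := by simp; linarith
  have h0 : (a : ℂ) + z ≠ 0 := by
    intro h
    rw [h] at hre
    simp at hre
  rw [expMeasure, gammaMeasure]
  have : gammaPDF 1 a = fun x => ((gammaPDFReal 1 a x).toNNReal : ℝ≥0∞) := rfl
  rw [this, integral_withDensity_eq_integral_smul hm.real_toNNReal]
  have h2 : ∀ x : ℝ, (gammaPDFReal 1 a x).toNNReal • Complex.exp (-z * (x : ℂ)) =
      (Ici 0).indicator (fun x : ℝ => (a : ℂ) * Complex.exp (-((a : ℂ) + z) * x)) x := by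
    intro x
    have h3 : gammaPDFReal 1 a x = if 0 ≤ x then a * Real.exp (-(a * x)) else 0 := by
      simp [gammaPDFReal]
    have h4 : (0 : ℝ) ≤ gammaPDFReal 1 a x := gammaPDFReal_nonneg one_pos ha x
    rw [NNReal.smul_def, Real.coe_toNNReal _ h4, h3]
    by_cases hx : 0 ≤ x
    · rw [indicator_of_mem (show x ∈ Ici 0 from hx), if_pos hx, Complex.real_smul]
      push_cast
      rw [mul_assoc, ← Complex.exp_add]
      congr 2; ring
    · rw [indicator_of_notMem (show x ∉ Ici 0 from hx), if_neg hx]; simp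
  simp_rw [h2]
  rw [integral_indicator measurableSet_Ici, integral_const_mul, integral_Ici_eq_integral_Ioi,
    integral_exp_mul_complex_Ioi hre]
  simp only [Complex.ofReal_zero, mul_zero, Complex.exp_zero]
  rw [neg_div_neg_eq, mul_one_div]

end

/-! ### The canonical space of marked points and the law of the input on it. -/

section

/-- The marked points of one source, each given by the gap to its predecessor and its mark,
with a point put in front. -/
def srcCons (p : ℝ × ℝ) (y : ℕ → ℝ × ℝ) : ℕ → ℝ × ℝ
  | 0 => p
  | n + 1 => y n

/-- The marked points of one source, all delayed by `r`. -/
def srcDelay (r : ℝ) (y : ℕ → ℝ × ℝ) : ℕ → ℝ × ℝ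
  | 0 => (r + (y 0).1, (y 0).2)
  | n + 1 => y (n + 1)

@[fun_prop]
theorem measurable_srcCons : Measurable fun p : (ℝ × ℝ) × (ℕ → ℝ × ℝ) => srcCons p.1 p.2 := by
  refine measurable_pi_lambda _ fun n => ?_
  cases n with
  | zero => exact measurable_fst
  | succ n => exact (measurable_pi_apply n).comp measurable_snd

@[fun_prop]
theorem measurable_srcDelay : Measurable fun p : ℝ × (ℕ → ℝ × ℝ) => srcDelay p.1 p.2 := by
  refine measurable_pi_lambda _ fun n => ?_
  cases n with
  | zero => simp only [srcDelay]; fun_prop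
  | succ n => exact (measurable_pi_apply (n + 1)).comp measurable_snd

theorem srcDelay_srcCons (r : ℝ) (p : ℝ × ℝ) (y : ℕ → ℝ × ℝ) :
    srcDelay r (srcCons p y) = srcCons (r + p.1, p.2) y := by
  funext n; cases n <;> rfl

/-- This makes it possible to integrate over the first point of a source separately from the rest of
an i.i.d. sequence. -/
theorem map_srcCons (ν : Measure (ℝ × ℝ)) [IsProbabilityMeasure ν] :
    (ν.prod (Measure.infinitePi fun _ : ℕ => ν)).map (fun p => srcCons p.1 p.2) =
      Measure.infinitePi fun _ : ℕ => ν := by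
  classical
  refine Measure.eq_infinitePi _ fun s t ht => ?_
  -- Padding with `univ` turns a cylinder over an arbitrary finite set into one over an initial
  -- segment, where coordinate 0 splits off.
  set t' : ℕ → Set (ℝ × ℝ) := fun n => if n ∈ s then t n else univ with ht'
  have ht'm : ∀ n, MeasurableSet (t' n) := fun n => by
    simp only [ht']; split_ifs
    exacts [ht n, .univ]
  obtain ⟨M, hM⟩ : ∃ M, s ⊆ Finset.range (M + 1) :=
    ⟨s.sup id, fun n hn => Finset.mem_range_succ_iff.2 (Finset.le_sup (f := id) hn)⟩
  have hpi : Set.pi (s : Set ℕ) t = Set.pi (Finset.range (M + 1) : Set ℕ) t' := by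
    ext y
    simp only [Set.mem_pi, ht', Finset.mem_coe]
    refine ⟨fun h n _ => ?_, fun h n hn => by simpa [hn] using h n (hM hn)⟩
    split_ifs with hn
    exacts [h n hn, mem_univ _]
  have hprod : ∏ n ∈ s, ν (t n) = ∏ n ∈ Finset.range (M + 1), ν (t' n) := by
    rw [← Finset.prod_subset hM (f := fun n => ν (t' n)) fun n _ hn => by simp [ht', hn]]
    exact Finset.prod_congr rfl fun n hn => by simp [ht', hn]
  have hpre : (fun p : (ℝ × ℝ) × (ℕ → ℝ × ℝ) => srcCons p.1 p.2) ⁻¹'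
      Set.pi (Finset.range (M + 1) : Set ℕ) t' =
      t' 0 ×ˢ Set.pi (Finset.range M : Set ℕ) (fun n => t' (n + 1)) := by
    ext ⟨p, y⟩
    simp only [mem_preimage, Set.mem_pi, Finset.coe_range, mem_Iio, mem_prod]
    refine ⟨fun h => ⟨h 0 (by omega), fun n hn => h (n + 1) (by omega)⟩, fun h n hn => ?_⟩
    cases n with
    | zero => exact h.1
    | succ n => exact h.2 n (by omega)
  rw [hpi, hprod, Measure.map_apply measurable_srcCons
    (MeasurableSet.pi (Finset.countable_toSet _) fun n _ => ht'm n), hpre, Measure.prod_prod,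
    Measure.infinitePi_pi _ (fun n _ => ht'm (n + 1)), Finset.prod_range_succ', mul_comm]

section Law

variable {Ω : Type*} [MeasurableSpace Ω] {P : Measure Ω}
  {N : ℕ} {rate : Fin N → ℝ} {σ : Measure ℝ} {X S : Fin N → ℕ → Ω → ℝ}

/-- The law of the family of gaps and service times. -/
noncomputable def dataLaw (rate : Fin N → ℝ) (σ : Measure ℝ) : Measure (Fin N → ℕ → ℝ × ℝ) :=
  Measure.pi fun j => Measure.infinitePi fun _ : ℕ => (expMeasure (rate j)).prod σ

/-- Joint independence identifies the law of all variables with one big product measure; regrouping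
it, first gap with service time and then by source, produces `dataLaw`. -/
theorem IsInput.map_eq_dataLaw [IsProbabilityMeasure σ] (hrate : ∀ j, 0 < rate j)
    (h : IsInput P rate σ X S) :
    P.map (fun ω j n => (X j n ω, S j n ω)) = dataLaw rate σ := by
  have hexp : ∀ j, IsProbabilityMeasure (expMeasure (rate j)) :=
    fun j => isProbabilityMeasure_expMeasure (hrate j)
  let Z : (p : Fin N × ℕ) → Bool → Ω → ℝ := fun p b => bif b then X p.1 p.2 else S p.1 p.2
  let ν : (p : Fin N × ℕ) → Bool → Measure ℝ := fun p b => bif b then expMeasure (rate p.1) else σ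
  have hνp : ∀ p b, IsProbabilityMeasure (ν p b) := by
    rintro p (_ | _)
    exacts [inferInstanceAs (IsProbabilityMeasure σ), hexp p.1]
  have hZm : ∀ p b, Measurable (Z p b) := by
    rintro p (_ | _)
    exacts [h.measurable_S _ _, h.measurable_X _ _]
  have hZlaw : ∀ p b, P.map (Z p b) = ν p b := by
    rintro p (_ | _)
    exacts [h.law_S _ _, h.law_X _ _]
  have hZ : iIndepFun (fun q : (_ : Fin N × ℕ) × Bool => Z q.1 q.2) P := by
    -- The sum type is reindexed by a sigma type over `Bool`, the form in which infinite products
    -- can be curried.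
    let g : ((_ : Fin N × ℕ) × Bool) → (Fin N × ℕ) ⊕ (Fin N × ℕ) :=
      fun q => bif q.2 then .inl q.1 else .inr q.1
    have hg : Function.Injective g := by
      rintro ⟨p, _ | _⟩ ⟨q, _ | _⟩ hpq <;> simp_all [g]
    have hcomp := h.indep.precomp hg
    convert! hcomp using 1
    funext q
    rcases q with ⟨p, _ | _⟩ <;> rfl
  have h1 : P.map (fun ω (q : (_ : Fin N × ℕ) × Bool) => Z q.1 q.2 ω) =
      Measure.infinitePi fun q : (_ : Fin N × ℕ) × Bool => ν q.1 q.2 := by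
    rw [hZ.map_fun_eq_infinitePi_map (fun q => hZm _ _)]
    simp_rw [hZlaw]
  have h2 : P.map (fun ω (p : Fin N × ℕ) (b : Bool) => Z p b ω) =
      Measure.infinitePi fun p : Fin N × ℕ => Measure.infinitePi fun b : Bool => ν p b := by
    rw [← Measure.infinitePi_map_piCurry (fun p b => ν p b), ← h1,
      Measure.map_map (by fun_prop) (by fun_prop)]
    rfl
  have h3 : P.map (fun ω (p : Fin N × ℕ) => (X p.1 p.2 ω, S p.1 p.2 ω)) =
      Measure.infinitePi fun p : Fin N × ℕ => (expMeasure (rate p.1)).prod σ := by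
    have hpair : ∀ p : Fin N × ℕ, (Measure.infinitePi fun b : Bool => ν p b).map
        (fun f => (f true, f false)) = (expMeasure (rate p.1)).prod σ :=
      fun p => Measure.infinitePi_map_eval_prod (by simp)
    have := Measure.infinitePi_map_pi
      (μ := fun p : Fin N × ℕ => Measure.infinitePi fun b : Bool => ν p b)
      (f := fun _ f => (f true, f false)) (fun p => by fun_prop)
    simp_rw [hpair] at this
    rw [← this, ← h2, Measure.map_map (by fun_prop) (by fun_prop)]
    rfl
  rw [dataLaw, ← Measure.infinitePi_eq_pi, ← Measure.infinitePi_map_curry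
    (fun (j : Fin N) (_ : ℕ) => (expMeasure (rate j)).prod σ), ← h3,
      Measure.map_map (by fun_prop) (measurable_pi_lambda _ fun p =>
        (h.measurable_X _ _).prodMk (h.measurable_S _ _))]
  rfl

end Law

end

/-! ### Delaying paths and isolating one source. -/

section

theorem srcDelay_zero (y : ℕ → ℝ × ℝ) : srcDelay 0 y = y := by
  funext n; cases n <;> simp [srcDelay]

section Source

variable {a : ℝ} {σ : Measure ℝ} [IsProbabilityMeasure σ]

theorem lintegral_srcLaw (ha : 0 < a) {f : (ℕ → ℝ × ℝ) → ℝ≥0∞} (hf : Measurable f) :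
    ∫⁻ y, f y ∂(Measure.infinitePi fun _ : ℕ => (expMeasure a).prod σ) =
      ∫⁻ p, ∫⁻ y, f (srcCons p y) ∂(Measure.infinitePi fun _ : ℕ => (expMeasure a).prod σ)
        ∂(expMeasure a).prod σ := by
  have := isProbabilityMeasure_expMeasure ha
  conv_lhs => rw [← map_srcCons]
  rw [lintegral_map hf (by fun_prop), lintegral_prod _ (by fun_prop)]

/-- With the first gap innermost, facts about the exponential law apply while the rest of the path
is frozen. -/
theorem lintegral_srcLaw_symm (ha : 0 < a) {f : (ℕ → ℝ × ℝ) → ℝ≥0∞} (hf : Measurable f) :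
    ∫⁻ y, f y ∂(Measure.infinitePi fun _ : ℕ => (expMeasure a).prod σ) =
      ∫⁻ y, ∫⁻ s, ∫⁻ x, f (srcCons (x, s) y) ∂expMeasure a ∂σ
        ∂(Measure.infinitePi fun _ : ℕ => (expMeasure a).prod σ) := by
  have := isProbabilityMeasure_expMeasure ha
  rw [lintegral_srcLaw ha hf, lintegral_lintegral_swap (by fun_prop)]
  exact lintegral_congr fun y => lintegral_prod_symm' _ (by fun_prop)

/-- A delay alters the first gap only, so memorylessness of that gap is memorylessness of the whole
marked process. -/
theorem restrict_srcLaw (ha : 0 < a) {r : ℝ} (hr : 0 ≤ r) :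
    (Measure.infinitePi fun _ : ℕ => (expMeasure a).prod σ).restrict {y | r ≤ (y 0).1} =
      ENNReal.ofReal (Real.exp (-(a * r))) •
        (Measure.infinitePi fun _ : ℕ => (expMeasure a).prod σ).map (srcDelay r) := by
  have := isProbabilityMeasure_expMeasure ha
  have hms : MeasurableSet {y : ℕ → ℝ × ℝ | r ≤ (y 0).1} :=
    measurableSet_le measurable_const (by fun_prop)
  have hmd : Measurable (srcDelay r) := by fun_prop
  refine Measure.ext_of_lintegral _ fun f hf => ?_
  have hfd : Measurable fun y => f (srcDelay r y) := hf.comp hmd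
  rw [← lintegral_indicator hms, lintegral_smul_measure, lintegral_map hf hmd,
    lintegral_srcLaw_symm ha (hf.indicator hms),
    lintegral_srcLaw_symm ha (f := fun y => f (srcDelay r y)) hfd, smul_eq_mul,
    ← lintegral_const_mul _ (by fun_prop)]
  refine lintegral_congr fun y => ?_
  rw [← lintegral_const_mul _ (by fun_prop)]
  refine lintegral_congr fun s => ?_
  have := setLIntegral_expMeasure_Ici (a := a) hr (f := fun x => f (srcCons (x, s) y))
    (by fun_prop)
  rw [← lintegral_indicator measurableSet_Ici] at this
  simp only [srcDelay_srcCons, add_comm r]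
  rw [← this]
  rfl

end Source

variable {N : ℕ}

/-- The marked points of all sources, those of source `j` delayed by `r j`. -/
def delay (r : Fin N → ℝ) (d : Fin N → ℕ → ℝ × ℝ) : Fin N → ℕ → ℝ × ℝ :=
  fun j => srcDelay (r j) (d j)

/-- The marked points of all sources, delayed by `p.1`, with a new first point of source `j` at time
`p.1` with mark `p.2`. -/
def insertFirst (j : Fin N) (p : ℝ × ℝ) (d : Fin N → ℕ → ℝ × ℝ) : Fin N → ℕ → ℝ × ℝ :=
  fun k => if k = j then srcCons p (d k) else srcDelay p.1 (d k)

@[fun_prop]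
theorem measurable_delay :
    Measurable fun p : (Fin N → ℝ) × (Fin N → ℕ → ℝ × ℝ) => delay p.1 p.2 := by
  refine measurable_pi_lambda _ fun k => ?_
  simp only [delay]; fun_prop

@[fun_prop]
theorem measurable_insertFirst (j : Fin N) :
    Measurable fun p : (ℝ × ℝ) × (Fin N → ℕ → ℝ × ℝ) => insertFirst j p.1 p.2 := by
  refine measurable_pi_lambda _ fun k => ?_
  by_cases h : k = j
  · simp only [insertFirst, h, if_true]; fun_prop
  · simp only [insertFirst, h, if_false]; fun_prop

variable {rate : Fin N → ℝ} {σ : Measure ℝ} [IsProbabilityMeasure σ]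

theorem isProbabilityMeasure_dataLaw (hrate : ∀ j, 0 < rate j) :
    IsProbabilityMeasure (dataLaw rate σ) := by
  have := fun j => isProbabilityMeasure_expMeasure (hrate j)
  unfold dataLaw; infer_instance

/-- Conditionally on the absence of points of source `j` before time `r j`, for all `j`, the marked
points after these times have the original law. -/
theorem setLIntegral_dataLaw_le (hrate : ∀ j, 0 < rate j) {r : Fin N → ℝ} (hr : ∀ j, 0 ≤ r j)
    {f : (Fin N → ℕ → ℝ × ℝ) → ℝ≥0∞} (hf : Measurable f) :
    ∫⁻ d in {d | ∀ j, r j ≤ (d j 0).1}, f d ∂dataLaw rate σ =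
      ENNReal.ofReal (Real.exp (-∑ j, rate j * r j)) * ∫⁻ d, f (delay r d) ∂dataLaw rate σ := by
  have := fun j => isProbabilityMeasure_expMeasure (hrate j)
  have hset : {d : Fin N → ℕ → ℝ × ℝ | ∀ j, r j ≤ (d j 0).1} =
      Set.pi univ fun j => {y | r j ≤ (y 0).1} := by ext; simp
  have hmd : ∀ j, Measurable (srcDelay (r j)) := fun j => by fun_prop
  have hmap : (dataLaw rate σ).restrict {d | ∀ j, r j ≤ (d j 0).1} =
      ENNReal.ofReal (Real.exp (-∑ j, rate j * r j)) • (dataLaw rate σ).map (delay r) := by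
    rw [dataLaw, hset, Measure.restrict_pi_pi]
    have hprob : ∀ j, IsProbabilityMeasure
        ((Measure.infinitePi fun _ : ℕ => (expMeasure (rate j)).prod σ).map (srcDelay (r j))) :=
      fun j => Measure.isProbabilityMeasure_map (hmd j).aemeasurable
    have hpi := Measure.pi_map_pi
      (μ := fun j => Measure.infinitePi fun _ : ℕ => (expMeasure (rate j)).prod σ)
      (f := fun j => srcDelay (r j)) (fun j => (hmd j).aemeasurable)
    have hpi' : (Measure.pi fun j => Measure.infinitePi
        fun _ : ℕ => (expMeasure (rate j)).prod σ).map (delay r) = _ := hpi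
    rw [hpi']
    refine Measure.pi_eq fun s hs => ?_
    rw [Measure.smul_apply, Measure.pi_pi, ← Finset.sum_neg_distrib, Real.exp_sum,
      ENNReal.ofReal_prod_of_nonneg fun _ _ => (Real.exp_pos _).le, smul_eq_mul,
      ← Finset.prod_mul_distrib]
    refine Finset.prod_congr rfl fun j _ => ?_
    rw [restrict_srcLaw (hrate j) (hr j), Measure.smul_apply, smul_eq_mul]
  rw [hmap, lintegral_smul_measure, lintegral_map hf (by fun_prop), smul_eq_mul]

/-- Resampling one factor of a product law does not change it. This isolates source j without
splitting the product over the sources. -/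
theorem lintegral_dataLaw_update (hrate : ∀ j, 0 < rate j) (j : Fin N)
    {f : (Fin N → ℕ → ℝ × ℝ) → ℝ≥0∞} (hf : Measurable f) :
    ∫⁻ d, f d ∂dataLaw rate σ = ∫⁻ d, ∫⁻ y, f (Function.update d j y)
      ∂(Measure.infinitePi fun _ : ℕ => (expMeasure (rate j)).prod σ) ∂dataLaw rate σ := by
  have := fun j => isProbabilityMeasure_expMeasure (hrate j)
  have := isProbabilityMeasure_dataLaw (σ := σ) hrate
  have hm : Measurable fun p : (Fin N → ℕ → ℝ × ℝ) × (ℕ → ℝ × ℝ) =>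
      Function.update p.1 j p.2 := by
    refine measurable_pi_lambda _ fun k => ?_
    by_cases h : k = j
    · subst h; simp only [Function.update_self]; fun_prop
    · simp only [Function.update_of_ne h]; fun_prop
  rw [← lintegral_prod (fun p : (Fin N → ℕ → ℝ × ℝ) × (ℕ → ℝ × ℝ) =>
    f (Function.update p.1 j p.2)) (hf.comp hm).aemeasurable, ← lintegral_map hf hm]
  congr 1
  refine Measure.pi_eq fun s hs => ?_
  have hpre : (fun p : (Fin N → ℕ → ℝ × ℝ) × (ℕ → ℝ × ℝ) => Function.update p.1 j p.2) ⁻¹'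
      Set.pi univ s = Set.pi univ (Function.update s j univ) ×ˢ s j := by
    ext ⟨d, y⟩
    simp only [mem_preimage, Set.mem_pi, mem_univ, true_implies, mem_prod]
    refine ⟨fun h => ⟨fun k => ?_, by simpa using h j⟩, fun h k => ?_⟩
    · by_cases hk : k = j
      · subst hk; simp
      · simpa [Function.update_of_ne hk] using h k
    · by_cases hk : k = j
      · subst hk; simpa using h.2
      · simpa [Function.update_of_ne hk] using h.1 k
  rw [Measure.map_apply hm (MeasurableSet.univ_pi hs), hpre, Measure.prod_prod, dataLaw,
    Measure.pi_pi, ← Finset.prod_erase_mul _ _ (Finset.mem_univ j),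
    ← Finset.prod_erase_mul _ _ (Finset.mem_univ j)]
  simp only [Function.update_self, measure_univ, mul_one]
  congr 1
  refine Finset.prod_congr rfl fun k hk => ?_
  rw [Function.update_of_ne (Finset.ne_of_mem_erase hk)]

/-- The first point of source j becomes an explicit variable, while its later points and the other
sources still form a full `dataLaw` sample. -/
theorem lintegral_dataLaw_cons (hrate : ∀ j, 0 < rate j) (j : Fin N)
    {f : (Fin N → ℕ → ℝ × ℝ) → ℝ≥0∞} (hf : Measurable f) :
    ∫⁻ d, f d ∂dataLaw rate σ = ∫⁻ p, ∫⁻ d, f (Function.update d j (srcCons p (d j)))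
      ∂dataLaw rate σ ∂(expMeasure (rate j)).prod σ := by
  have := fun j => isProbabilityMeasure_expMeasure (hrate j)
  have := isProbabilityMeasure_dataLaw (σ := σ) hrate
  have hm : Measurable fun p : (Fin N → ℕ → ℝ × ℝ) × (ℕ → ℝ × ℝ) =>
      Function.update p.1 j p.2 := by
    refine measurable_pi_lambda _ fun k => ?_
    by_cases h : k = j
    · subst h; simp only [Function.update_self]; fun_prop
    · simp only [Function.update_of_ne h]; fun_prop
  have hF : Measurable fun p : (Fin N → ℕ → ℝ × ℝ) × (ℕ → ℝ × ℝ) =>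
      f (Function.update p.1 j p.2) := hf.comp hm
  rw [lintegral_dataLaw_update hrate j hf]
  have h1 : ∀ d : Fin N → ℕ → ℝ × ℝ, ∫⁻ y, f (Function.update d j y)
      ∂(Measure.infinitePi fun _ : ℕ => (expMeasure (rate j)).prod σ) =
      ∫⁻ p, ∫⁻ y, f (Function.update d j (srcCons p y))
        ∂(Measure.infinitePi fun _ : ℕ => (expMeasure (rate j)).prod σ)
          ∂(expMeasure (rate j)).prod σ :=
    fun d => lintegral_srcLaw (hrate j) (f := fun y => f (Function.update d j y))
      (hF.comp (measurable_const.prodMk measurable_id))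
  simp_rw [h1]
  have hF3 : Measurable fun q : ((Fin N → ℕ → ℝ × ℝ) × (ℝ × ℝ)) × (ℕ → ℝ × ℝ) =>
      f (Function.update q.1.1 j (srcCons q.1.2 q.2)) :=
    hF.comp (f := fun q : ((Fin N → ℕ → ℝ × ℝ) × (ℝ × ℝ)) × (ℕ → ℝ × ℝ) =>
      (q.1.1, srcCons q.1.2 q.2)) (by fun_prop)
  rw [lintegral_lintegral_swap hF3.lintegral_prod_right'.aemeasurable]
  refine lintegral_congr fun p => ?_
  have hF4 : Measurable fun d : Fin N → ℕ → ℝ × ℝ => f (Function.update d j (srcCons p (d j))) :=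
    hF.comp (g := fun p : (Fin N → ℕ → ℝ × ℝ) × (ℕ → ℝ × ℝ) => f (Function.update p.1 j p.2))
      (f := fun d => (d, srcCons p (d j))) (by fun_prop)
  rw [lintegral_dataLaw_update hrate j hF4]
  simp

theorem ae_dataLaw_pos (hrate : ∀ j, 0 < rate j) (hσ : σ (Iio 0) = 0) :
    ∀ᵐ d ∂dataLaw rate σ, ∀ j n, 0 < (d j n).1 ∧ 0 ≤ (d j n).2 := by
  have := fun j => isProbabilityMeasure_expMeasure (hrate j)
  rw [ae_all_iff]
  intro j
  have h1 : ∀ᵐ p ∂(expMeasure (rate j)).prod σ, 0 < p.1 ∧ 0 ≤ p.2 := by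
    refine (Measure.quasiMeasurePreserving_fst.ae (ae_expMeasure_pos (rate j))).and
      (Measure.quasiMeasurePreserving_snd.ae (p := fun x => 0 ≤ x) ?_)
    rw [ae_iff]
    simpa [Iio] using hσ
  have h2 : ∀ᵐ y ∂(Measure.infinitePi fun _ : ℕ => (expMeasure (rate j)).prod σ),
      ∀ n, 0 < (y n).1 ∧ 0 ≤ (y n).2 := by
    rw [ae_all_iff]
    exact fun n => (measurePreserving_eval_infinitePi
      (fun _ : ℕ => (expMeasure (rate j)).prod σ) n).quasiMeasurePreserving.ae h1
  exact (Measure.quasiMeasurePreserving_eval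
    (fun j => Measure.infinitePi fun _ : ℕ => (expMeasure (rate j)).prod σ) j).ae h2

omit [IsProbabilityMeasure σ] in
theorem ae_firstPoint (hσ : σ (Iio 0) = 0) (a : ℝ) [IsProbabilityMeasure (expMeasure a)] :
    ∀ᵐ p ∂(expMeasure a).prod σ, 0 < p.1 ∧ 0 ≤ p.2 := by
  refine (Measure.quasiMeasurePreserving_fst.ae (ae_expMeasure_pos a)).and
    (Measure.quasiMeasurePreserving_snd.ae (p := fun x => 0 ≤ x) ?_)
  rw [ae_iff]
  simpa [Iio] using hσ

end

/-! ### Decomposition at the first point of the superposed process. -/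

section

variable {N : ℕ} {rate : Fin N → ℝ} {σ : Measure ℝ} [IsProbabilityMeasure σ]

/-- The law of the marked points on the event that the first one is from source `j`. -/
theorem setLIntegral_dataLaw_isFirst (hrate : ∀ j, 0 < rate j) (hσ : σ (Iio 0) = 0) (j : Fin N)
    {f : (Fin N → ℕ → ℝ × ℝ) → ℝ≥0∞} (hf : Measurable f) :
    ∫⁻ d in {d | ∀ k, (d j 0).1 ≤ (d k 0).1}, f d ∂dataLaw rate σ =
      ENNReal.ofReal (rate j / ∑ k, rate k) *
        ∫⁻ p, ∫⁻ d, f (insertFirst j p d) ∂dataLaw rate σ ∂(expMeasure (∑ k, rate k)).prod σ := by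
  have hsum : rate j + ∑ k ∈ Finset.univ.erase j, rate k = ∑ k, rate k :=
    Finset.add_sum_erase _ _ (Finset.mem_univ j)
  have hb : 0 ≤ ∑ k ∈ Finset.univ.erase j, rate k := Finset.sum_nonneg fun k _ => (hrate k).le
  have := fun j => isProbabilityMeasure_expMeasure (hrate j)
  have : IsProbabilityMeasure (expMeasure (∑ k, rate k)) :=
    isProbabilityMeasure_expMeasure (by have := hrate j; linarith)
  have := isProbabilityMeasure_dataLaw (σ := σ) hrate
  have hms : MeasurableSet {d : Fin N → ℕ → ℝ × ℝ | ∀ k, (d j 0).1 ≤ (d k 0).1} :=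
    measurableSet_setOfPred.2 (Measurable.forall fun k => measurableSet_setOfPred.1
      (measurableSet_le (by fun_prop) (by fun_prop)))
  have hfi : ∀ p : ℝ × ℝ, Measurable fun d => f (insertFirst j p d) := fun p => by fun_prop
  have key : ∀ p : ℝ × ℝ, 0 < p.1 →
      ∫⁻ d, {d : Fin N → ℕ → ℝ × ℝ | ∀ k, (d j 0).1 ≤ (d k 0).1}.indicator f
        (Function.update d j (srcCons p (d j))) ∂dataLaw rate σ =
      ENNReal.ofReal (Real.exp (-((∑ k ∈ Finset.univ.erase j, rate k) * p.1))) *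
        ∫⁻ d, f (insertFirst j p d) ∂dataLaw rate σ := by
    intro p hp
    -- Once the first point of source j is fixed at `p.1`, being first only constrains the other
    -- sources to be empty before `p.1`; hence the value 0 at j.
    set r : Fin N → ℝ := fun k => if k = j then 0 else p.1 with hr
    have hr0 : ∀ k, 0 ≤ r k := fun k => by
      simp only [hr]; split_ifs
      exacts [le_rfl, hp.le]
    have hrsum : ∑ k, rate k * r k = (∑ k ∈ Finset.univ.erase j, rate k) * p.1 := by
      rw [← Finset.add_sum_erase _ _ (Finset.mem_univ j), Finset.sum_mul]
      simp only [hr, if_true, mul_zero, zero_add]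
      exact Finset.sum_congr rfl fun k hk => by rw [if_neg (Finset.ne_of_mem_erase hk)]
    have hupd : ∀ d, Function.update (delay r d) j (srcCons p (delay r d j)) =
        insertFirst j p d := by
      intro d; funext k
      by_cases hk : k = j
      · subst hk; simp [insertFirst, delay, hr, srcDelay_zero]
      · simp [insertFirst, delay, hr, hk]
    have hfu : Measurable fun d : Fin N → ℕ → ℝ × ℝ =>
        f (Function.update d j (srcCons p (d j))) := by
      refine hf.comp (measurable_pi_lambda _ fun k => ?_)
      by_cases hk : k = j
      · subst hk; simp only [Function.update_self]; fun_prop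
      · simp only [Function.update_of_ne hk]; fun_prop
    have hmr : MeasurableSet {d : Fin N → ℕ → ℝ × ℝ | ∀ k, r k ≤ (d k 0).1} :=
      measurableSet_setOfPred.2 (Measurable.forall fun k => measurableSet_setOfPred.1
        (measurableSet_le (by fun_prop) (by fun_prop)))
    have h := setLIntegral_dataLaw_le (σ := σ) hrate hr0 hfu
    simp_rw [hupd, hrsum] at h
    rw [← h, ← lintegral_indicator hmr]
    refine lintegral_congr_ae ?_
    filter_upwards [ae_dataLaw_pos hrate hσ] with d hd
    have hiff : Function.update d j (srcCons p (d j)) ∈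
        {d : Fin N → ℕ → ℝ × ℝ | ∀ k, (d j 0).1 ≤ (d k 0).1} ↔ d ∈ {d | ∀ k, r k ≤ (d k 0).1} := by
      refine forall_congr' fun k => ?_
      by_cases hk : k = j
      · subst hk; simp [hr, (hd k 0).1.le]
      · simp [hr, hk, srcCons]
    by_cases hmem : d ∈ {d : Fin N → ℕ → ℝ × ℝ | ∀ k, r k ≤ (d k 0).1}
    · rw [indicator_of_mem hmem, indicator_of_mem (hiff.2 hmem)]
    · rw [indicator_of_notMem hmem, indicator_of_notMem (mt hiff.1 hmem)]
  have hG : Measurable fun p : ℝ × ℝ => ∫⁻ d, f (insertFirst j p d) ∂dataLaw rate σ :=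
    Measurable.lintegral_prod_right' (f := fun q : (ℝ × ℝ) × (Fin N → ℕ → ℝ × ℝ) =>
      f (insertFirst j q.1 q.2)) (by fun_prop)
  rw [← lintegral_indicator hms, lintegral_dataLaw_cons hrate j (hf.indicator hms),
    lintegral_congr_ae (g := fun p => ENNReal.ofReal (Real.exp
      (-((∑ k ∈ Finset.univ.erase j, rate k) * p.1))) *
        ∫⁻ d, f (insertFirst j p d) ∂dataLaw rate σ)
      (by filter_upwards [ae_firstPoint hσ (rate j)] with p hp using key p hp.1),
    lintegral_prod_symm' _ (by fun_prop), lintegral_prod_symm' _ hG,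
    ← lintegral_const_mul _ (hG.lintegral_prod_left')]
  refine lintegral_congr fun s => ?_
  -- The void probability of the other sources tilts Exp(rate j) into Exp(Λ), with total mass rate j
  -- / Λ.
  have := lintegral_exp_mul_expMeasure (hrate j) hb
    (f := fun x => ∫⁻ d, f (insertFirst j (x, s) d) ∂dataLaw rate σ)
    (hG.comp (g := fun p : ℝ × ℝ => ∫⁻ d, f (insertFirst j p d) ∂dataLaw rate σ)
      (f := fun x => (x, s)) (by fun_prop))
  rw [hsum] at this
  exact this

/-- Decomposition of the law of the marked points according to the first one. -/
theorem dataLaw_eq_sum (hrate : ∀ j, 0 < rate j) (hσ : σ (Iio 0) = 0) (i : Fin N) :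
    dataLaw rate σ = ∑ j, ENNReal.ofReal (rate j / ∑ k, rate k) •
      ((((expMeasure (∑ k, rate k)).prod σ).prod (dataLaw rate σ)).map
        fun q => insertFirst j q.1 q.2) := by
  have hpos : 0 < ∑ k, rate k := Finset.sum_pos (fun k _ => hrate k) ⟨i, Finset.mem_univ i⟩
  have : IsProbabilityMeasure (expMeasure (∑ k, rate k)) := isProbabilityMeasure_expMeasure hpos
  have := isProbabilityMeasure_dataLaw (σ := σ) hrate
  have hms : ∀ j, MeasurableSet {d : Fin N → ℕ → ℝ × ℝ | ∀ k, (d j 0).1 ≤ (d k 0).1} := fun j =>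
    measurableSet_setOfPred.2 (Measurable.forall fun k => measurableSet_setOfPred.1
      (measurableSet_le (by fun_prop) (by fun_prop)))
  have hmap : ∀ j, (dataLaw rate σ).restrict {d | ∀ k, (d j 0).1 ≤ (d k 0).1} =
      ENNReal.ofReal (rate j / ∑ k, rate k) •
      ((((expMeasure (∑ k, rate k)).prod σ).prod (dataLaw rate σ)).map
        fun q => insertFirst j q.1 q.2) := by
    intro j
    refine Measure.ext_of_lintegral _ fun f hf => ?_
    rw [setLIntegral_dataLaw_isFirst hrate hσ j hf, lintegral_smul_measure,
      lintegral_map hf (by fun_prop), smul_eq_mul,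
      lintegral_prod (fun q : (ℝ × ℝ) × (Fin N → ℕ → ℝ × ℝ) => f (insertFirst j q.1 q.2))
        (by fun_prop)]
  simp_rw [← hmap]
  -- The events that source j comes first cover the space but overlap at ties. Covering gives an
  -- inequality of measures, and equality of total masses upgrades it, so ties need no separate
  -- treatment.
  refine Measure.eq_of_le_of_measure_univ_eq ?_ ?_
  · refine Measure.le_iff.2 fun s hs => ?_
    rw [Measure.finsetSum_apply]
    simp_rw [Measure.restrict_apply hs]
    refine (measure_mono fun d hd => ?_).trans (measure_iUnion_fintype_le _ _)
    have : Nonempty (Fin N) := ⟨i⟩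
    obtain ⟨j, hj⟩ := Finite.exists_min fun k => (d k 0).1
    exact mem_iUnion.2 ⟨j, hd, hj⟩
  · simp_rw [hmap]
    rw [Measure.finsetSum_apply]
    have hp : ∀ j, IsProbabilityMeasure ((((expMeasure (∑ k, rate k)).prod σ).prod
        (dataLaw rate σ)).map fun q => insertFirst j q.1 q.2) :=
      fun j => Measure.isProbabilityMeasure_map (by fun_prop)
    simp only [Measure.smul_apply, measure_univ, smul_eq_mul, mul_one]
    rw [← ENNReal.ofReal_sum_of_nonneg fun j _ => (div_pos (hrate j) hpos).le, ← Finset.sum_div,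
      div_self hpos.ne', ENNReal.ofReal_one]

end

/-! ### Effect of an insertion or a delay on arrivals, receptions and departures. -/

section

/-- Gap in front of point `n` of source `j`, as a function of the marked points. -/
def gap {N : ℕ} (j : Fin N) (n : ℕ) (d : Fin N → ℕ → ℝ × ℝ) : ℝ := (d j n).1

/-- Mark of point `n` of source `j`, as a function of the marked points. -/
def service {N : ℕ} (j : Fin N) (n : ℕ) (d : Fin N → ℕ → ℝ × ℝ) : ℝ := (d j n).2

/-- All gaps are positive and all marks are nonnegative. -/
def Regular {N : ℕ} (d : Fin N → ℕ → ℝ × ℝ) : Prop := ∀ j n, 0 < (d j n).1 ∧ 0 ≤ (d j n).2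

variable {N : ℕ} {i j k : Fin N} {n : ℕ} {p : ℝ × ℝ} {r : ℝ} {d : Fin N → ℕ → ℝ × ℝ}

theorem arrival_zero : arrival gap j 0 d = (d j 0).1 := by simp [arrival, gap]

theorem arrival_succ : arrival gap j (n + 1) d = arrival gap j n d + (d j (n + 1)).1 := by
  simp [arrival, gap, Finset.sum_range_succ _ (n + 1)]

theorem Regular.arrival_strictMono (hd : Regular d) (j : Fin N) :
    StrictMono fun n => arrival gap j n d :=
  strictMono_nat_of_lt_succ fun n => by
    have := (hd j (n + 1)).1
    simp only [arrival_succ]; linarith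

theorem Regular.gap_le_arrival (hd : Regular d) (j : Fin N) (n : ℕ) :
    (d j 0).1 ≤ arrival gap j n d := by
  rw [← arrival_zero]; exact (hd.arrival_strictMono j).monotone (Nat.zero_le n)

theorem Regular.arrival_pos (hd : Regular d) (j : Fin N) (n : ℕ) : 0 < arrival gap j n d :=
  (hd j 0).1.trans_le (hd.gap_le_arrival j n)

theorem arrival_insertFirst_zero : arrival gap j 0 (insertFirst j p d) = p.1 := by
  simp [arrival_zero, insertFirst, srcCons]

theorem arrival_insertFirst_succ :
    arrival gap j (n + 1) (insertFirst j p d) = p.1 + arrival gap j n d := by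
  rw [arrival, Finset.sum_range_succ', add_comm]
  simp [arrival, gap, insertFirst, srcCons]

theorem arrival_srcDelay (d' : Fin N → ℕ → ℝ × ℝ) (h : d' k = srcDelay r (d k)) :
    arrival gap k n d' = r + arrival gap k n d := by
  rw [arrival, arrival, Finset.sum_range_succ', Finset.sum_range_succ']
  simp only [gap, h, srcDelay]
  ring

theorem arrival_insertFirst_of_ne (h : k ≠ j) :
    arrival gap k n (insertFirst j p d) = p.1 + arrival gap k n d :=
  arrival_srcDelay _ (by simp [insertFirst, h])

theorem arrival_delay : arrival gap k n (delay (fun _ => r) d) = r + arrival gap k n d :=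
  arrival_srcDelay _ rfl

theorem service_insertFirst_zero : service j 0 (insertFirst j p d) = p.2 := by
  simp [service, insertFirst, srcCons]

theorem service_insertFirst_succ : service j (n + 1) (insertFirst j p d) = service j n d := by
  simp [service, insertFirst, srcCons]

theorem service_srcDelay (d' : Fin N → ℕ → ℝ × ℝ) (h : d' k = srcDelay r (d k)) :
    service k n d' = service k n d := by
  cases n <;> simp [service, h, srcDelay]

theorem service_insertFirst_of_ne (h : k ≠ j) :
    service k n (insertFirst j p d) = service k n d :=
  service_srcDelay _ (by simp [insertFirst, h]; rfl)

theorem service_delay : service k n (delay (fun _ => r) d) = service k n d :=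
  service_srcDelay _ rfl

/-- The index shift in source j disappears when quantifying over all points: the new arrivals are
`p.1` and the old ones delayed. -/
theorem forall_arrival_insertFirst {Q : ℝ → Prop} :
    (∀ k m, Q (arrival gap k m (insertFirst j p d))) ↔
      Q p.1 ∧ ∀ k m, Q (p.1 + arrival gap k m d) := by
  refine ⟨fun h => ⟨?_, fun k m => ?_⟩, fun h k m => ?_⟩
  · simpa [arrival_insertFirst_zero] using h j 0
  · by_cases hk : k = j
    · subst hk; simpa [arrival_insertFirst_succ] using h k (m + 1)
    · simpa [arrival_insertFirst_of_ne hk] using h k m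
  · by_cases hk : k = j
    · subst hk
      cases m with
      | zero => simpa [arrival_insertFirst_zero] using h.1
      | succ m => simpa [arrival_insertFirst_succ] using h.2 k m
    · simpa [arrival_insertFirst_of_ne hk] using h.2 k m

theorem received_delay :
    Received gap service i (delay (fun _ => r) d) n ↔ Received gap service i d n := by
  simp [Received, arrival_delay, service_delay, add_assoc]

/-- The inserted point precedes all the others, hence it preempts none of them. -/
theorem received_insertFirst_of_ne (hd : Regular d) (h : j ≠ i) :
    Received gap service i (insertFirst j p d) n ↔ Received gap service i d n := by
  have := hd.arrival_pos i n
  rw [Received, arrival_insertFirst_of_ne h.symm, service_insertFirst_of_ne h.symm,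
    forall_arrival_insertFirst (Q := fun t => ¬ (p.1 + arrival gap i n d < t ∧
      t < p.1 + arrival gap i n d + service i n d)), Received]
  simp only [add_lt_add_iff_left, add_assoc]
  exact and_iff_right fun h => by linarith [h.1]

theorem received_insertFirst_succ (hd : Regular d) :
    Received gap service i (insertFirst i p d) (n + 1) ↔ Received gap service i d n := by
  have := hd.arrival_pos i n
  rw [Received, arrival_insertFirst_succ, service_insertFirst_succ,
    forall_arrival_insertFirst (Q := fun t => ¬ (p.1 + arrival gap i n d < t ∧
      t < p.1 + arrival gap i n d + service i n d)), Received]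
  simp only [add_lt_add_iff_left, add_assoc]
  exact and_iff_right fun h => by linarith [h.1]

/-- Only the first point of each source has to be compared with the service time, since it is the
earliest of that source. -/
theorem received_insertFirst_zero (hd : Regular d) :
    Received gap service i (insertFirst i p d) 0 ↔ ∀ k, p.2 ≤ (d k 0).1 := by
  rw [Received, arrival_insertFirst_zero, service_insertFirst_zero,
    forall_arrival_insertFirst (Q := fun t => ¬ (p.1 < t ∧ t < p.1 + p.2))]
  simp only [lt_irrefl, false_and, not_false_eq_true, true_and, lt_add_iff_pos_right,
    add_lt_add_iff_left, not_and, not_lt]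
  refine ⟨fun h k => ?_, fun h k m _ => (h k).trans (hd.gap_le_arrival k m)⟩
  simpa [arrival_zero] using h k 0 (hd.arrival_pos k 0)

/-- Infinitude excludes the default value 0 of `Nat.nth`, which would not shift. -/
theorem nth_eq_succ_of_not {P Q : ℕ → Prop} (h : ∀ n, Q (n + 1) ↔ P n) (h0 : ¬ Q 0)
    (hP : (Set.ofPred P).Infinite) (m : ℕ) : Nat.nth Q m = Nat.nth P m + 1 := by
  classical
  have hm : Q (Nat.nth P m + 1) := (h _).2 (Nat.nth_mem_of_infinite hP m)
  conv_rhs => rw [← Nat.nth_count hm]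
  rw [Nat.count_succ']
  simp [h, h0, Nat.count_nth_of_infinite hP]

theorem nth_succ_eq_succ {P Q : ℕ → Prop} (h : ∀ n, Q (n + 1) ↔ P n) (h0 : Q 0)
    (hP : (Set.ofPred P).Infinite) (m : ℕ) : Nat.nth Q (m + 1) = Nat.nth P m + 1 := by
  classical
  have hm : Q (Nat.nth P m + 1) := (h _).2 (Nat.nth_mem_of_infinite hP m)
  conv_rhs => rw [← Nat.nth_count hm]
  rw [Nat.count_succ']
  simp [h, h0, Nat.count_nth_of_infinite hP]

theorem departure_delay : departure gap service i (delay (fun _ => r) d) (n + 1) =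
    r + departure gap service i d (n + 1) := by
  have : Received gap service i (delay (fun _ => r) d) = Received gap service i d :=
    funext fun _ => propext received_delay
  simp only [departure, this]
  rw [arrival_delay, ← add_assoc]
  exact congrArg _ service_delay

/-- An inserted update of another source, or one preempted by the next point, only translates the
departures of source i. The index is `n + 1` because departure 0 is the convention 0, which does not
move. -/
theorem departure_insertFirst (hd : Regular d)
    (hinf : (Set.ofPred (Received gap service i d)).Infinite)
    (h : j ≠ i ∨ ∃ k, (d k 0).1 < p.2) (n : ℕ) :
    departure gap service i (insertFirst j p d) (n + 1) =
      p.1 + departure gap service i d (n + 1) := by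
  by_cases hj : j = i
  · subst hj
    have h0 : ¬ Received gap service j (insertFirst j p d) 0 := by
      rw [received_insertFirst_zero hd]
      push Not
      simpa using h
    simp only [departure]
    rw [nth_eq_succ_of_not (fun _ => received_insertFirst_succ hd) h0 hinf,
      arrival_insertFirst_succ, add_assoc]
    congr 2
    exact service_insertFirst_succ
  · have : Received gap service i (insertFirst j p d) = Received gap service i d :=
      funext fun _ => propext (received_insertFirst_of_ne hd hj)
    simp only [departure, this]
    rw [arrival_insertFirst_of_ne (Ne.symm hj), add_assoc]
    congr 2
    exact service_insertFirst_of_ne (Ne.symm hj)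

theorem departure_one_insertFirst (hd : Regular d) (h : ∀ k, p.2 ≤ (d k 0).1) :
    departure gap service i (insertFirst i p d) 1 = p.1 + p.2 := by
  have h0 := (received_insertFirst_zero (i := i) hd).2 h
  simp only [departure]
  rw [Nat.nth_zero_of_zero h0, arrival_insertFirst_zero]
  congr 1
  exact service_insertFirst_zero

/-- The inserted update is itself the first one received, so the ranks of the others go up by one.
-/
theorem departure_add_two_insertFirst (hd : Regular d)
    (hinf : (Set.ofPred (Received gap service i d)).Infinite) (h : ∀ k, p.2 ≤ (d k 0).1) (n : ℕ) :
    departure gap service i (insertFirst i p d) (n + 2) =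
      p.1 + departure gap service i d (n + 1) := by
  have h0 := (received_insertFirst_zero (i := i) hd).2 h
  simp only [departure]
  rw [nth_succ_eq_succ (fun _ => received_insertFirst_succ hd) h0 hinf,
    arrival_insertFirst_succ, add_assoc]
  congr 2
  exact service_insertFirst_succ

theorem Regular.delay (hd : Regular d) (hr : 0 ≤ r) : Regular (delay (fun _ => r) d) := by
  intro k n
  have := hd k n
  cases n with
  | zero => exact ⟨add_pos_of_nonneg_of_pos hr this.1, this.2⟩
  | succ n => exact this

theorem gap_delay_zero (k : Fin N) : (MG11.delay (fun _ => r) d k 0).1 = r + (d k 0).1 := rfl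

theorem Regular.insertFirst (hd : Regular d) (h1 : 0 < p.1) (h2 : 0 ≤ p.2) (j : Fin N) :
    Regular (insertFirst j p d) := by
  intro k n
  by_cases hk : k = j
  · cases n with
    | zero => simpa [MG11.insertFirst, hk, srcCons] using ⟨h1, h2⟩
    | succ n => simpa [MG11.insertFirst, hk, srcCons] using hd j n
  · have := hd k n
    cases n with
    | zero =>
      simpa [MG11.insertFirst, hk, srcDelay] using ⟨add_pos h1 this.1, this.2⟩
    | succ n => simpa [MG11.insertFirst, hk, srcDelay] using this

end

/-! ### First-step analysis. -/

section

variable {N : ℕ} {rate : Fin N → ℝ} {σ : Measure ℝ} [IsProbabilityMeasure σ]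

theorem measurableSet_forall_le_gap (s : ℝ) :
    MeasurableSet {d : Fin N → ℕ → ℝ × ℝ | ∀ k, s ≤ (d k 0).1} :=
  measurableSet_setOfPred.2 (Measurable.forall fun k => measurableSet_setOfPred.1
    (measurableSet_le (by fun_prop) (by fun_prop)))

theorem restrict_dataLaw_le (hrate : ∀ j, 0 < rate j) {s : ℝ} (hs : 0 ≤ s) :
    (dataLaw rate σ).restrict {d | ∀ k, s ≤ (d k 0).1} =
      ENNReal.ofReal (Real.exp (-((∑ k, rate k) * s))) •
        (dataLaw rate σ).map (delay fun _ => s) := by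
  refine Measure.ext_of_lintegral _ fun f hf => ?_
  rw [setLIntegral_dataLaw_le hrate (fun _ => hs) hf, lintegral_smul_measure,
    lintegral_map hf (by fun_prop), smul_eq_mul, ← Finset.sum_mul]

theorem setIntegral_dataLaw_le (hrate : ∀ j, 0 < rate j) {s : ℝ} (hs : 0 ≤ s)
    {f : (Fin N → ℕ → ℝ × ℝ) → ℂ} (hf : Measurable f) :
    ∫ d in {d | ∀ k, s ≤ (d k 0).1}, f d ∂dataLaw rate σ =
      Complex.exp (-((∑ k, rate k : ℝ) * s)) *
        ∫ d, f (delay (fun _ => s) d) ∂dataLaw rate σ := by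
  rw [restrict_dataLaw_le hrate hs, integral_smul_measure,
    integral_map (by fun_prop) hf.aestronglyMeasurable, ENNReal.toReal_ofReal (Real.exp_pos _).le,
    Complex.real_smul]
  push_cast
  rfl

/-- First step analysis for a functional of the marked points which is multiplied by `exp (-z x)`
when all points are delayed by `x` and an update which is not a received one of source `i` is
inserted at time `x`, and which becomes another functional when it is a received one. -/
theorem integral_eq_of_firstStep (hrate : ∀ j, 0 < rate j) (hσ : σ (Iio 0) = 0) (i : Fin N)
    {z : ℂ} (hz : 0 ≤ z.re) {F F' : (Fin N → ℕ → ℝ × ℝ) → ℂ}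
    (hF : Measurable F) (hb : ∀ d, ‖F d‖ ≤ 1)
    (h1 : ∀ᵐ d ∂dataLaw rate σ, ∀ p : ℝ × ℝ, 0 < p.1 → 0 ≤ p.2 → ∀ j,
      (j ≠ i ∨ ∃ k, (d k 0).1 < p.2) → F (insertFirst j p d) = Complex.exp (-z * p.1) * F d)
    (h2 : ∀ᵐ d ∂dataLaw rate σ, ∀ s : ℝ, 0 ≤ s →
      F (delay (fun _ => s) d) = Complex.exp (-z * s) * F d)
    (h3 : ∀ᵐ d ∂dataLaw rate σ, ∀ p : ℝ × ℝ, 0 < p.1 → 0 ≤ p.2 →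
      F (insertFirst i p (delay (fun _ => p.2) d)) =
        Complex.exp (-z * (p.1 + p.2 : ℝ)) * F' d) :
    z * ∫ d, F d ∂dataLaw rate σ = rate i * laplace σ ((∑ k, rate k : ℝ) + z) *
      (∫ d, F' d ∂dataLaw rate σ - ∫ d, F d ∂dataLaw rate σ) := by
  set Λ : ℝ := ∑ k, rate k with hΛ
  set μ := dataLaw rate σ with hμ
  have hpos : 0 < Λ := Finset.sum_pos (fun k _ => hrate k) ⟨i, Finset.mem_univ i⟩
  have : IsProbabilityMeasure (expMeasure Λ) := isProbabilityMeasure_expMeasure hpos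
  have : IsProbabilityMeasure μ := isProbabilityMeasure_dataLaw (σ := σ) hrate
  set κ := (expMeasure Λ).prod σ with hκ
  have hint : ∀ (ν : Measure (Fin N → ℕ → ℝ × ℝ)) [IsFiniteMeasure ν], Integrable F ν :=
    fun ν _ => Integrable.of_bound hF.aestronglyMeasurable 1 (ae_of_all _ hb)
  have hintj : ∀ j p, Integrable (fun d => F (insertFirst j p d)) μ := fun j p =>
    Integrable.of_bound (hF.comp (by fun_prop)).aestronglyMeasurable 1 (ae_of_all _ fun d => hb _)
  have hintq : ∀ j, Integrable (fun q : (ℝ × ℝ) × (Fin N → ℕ → ℝ × ℝ) =>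
      F (insertFirst j q.1 q.2)) (κ.prod μ) := fun j =>
    Integrable.of_bound (hF.comp (by fun_prop)).aestronglyMeasurable 1 (ae_of_all _ fun d => hb _)
  have hdecomp : ∫ d, F d ∂μ =
      ∑ j, ((rate j / Λ : ℝ) : ℂ) * ∫ p, ∫ d, F (insertFirst j p d) ∂μ ∂κ := by
    have hm := dataLaw_eq_sum hrate hσ i
    rw [← hμ, ← hΛ, ← hκ] at hm
    conv_lhs => rw [hm]
    rw [integral_finsetSum_measure fun j _ => (hint _).smul_measure ENNReal.ofReal_ne_top]
    refine Finset.sum_congr rfl fun j _ => ?_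
    rw [integral_smul_measure, integral_map (by fun_prop) hF.aestronglyMeasurable,
      integral_prod _ (hintq j), ENNReal.toReal_ofReal (div_pos (hrate j) hpos).le,
      Complex.real_smul]
  have hne : ∀ j, j ≠ i → ∫ p, ∫ d, F (insertFirst j p d) ∂μ ∂κ =
      ∫ p : ℝ × ℝ, Complex.exp (-z * p.1) * ∫ d, F d ∂μ ∂κ := by
    intro j hj
    refine integral_congr_ae ?_
    filter_upwards [ae_firstPoint hσ Λ] with p hp
    rw [← integral_const_mul]
    refine integral_congr_ae ?_
    filter_upwards [h1] with d hd using hd p hp.1 hp.2 j (Or.inl hj)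
  -- An update of source i with mark `p.2` succeeds on the event that no other point falls before
  -- `p.2`. There the path is a fresh one delayed by `p.2` and F' takes over; off this event the
  -- update only contributes the factor exp (-z x).
  have hi : ∫ p, ∫ d, F (insertFirst i p d) ∂μ ∂κ =
      ∫ p : ℝ × ℝ, (Complex.exp (-z * p.1) * ∫ d, F d ∂μ +
        Complex.exp (-z * p.1) * (Complex.exp (-(Λ + z) * p.2) *
          (∫ d, F' d ∂μ - ∫ d, F d ∂μ))) ∂κ := by
    refine integral_congr_ae ?_
    filter_upwards [ae_firstPoint hσ Λ] with p hp
    have hms := measurableSet_forall_le_gap (N := N) p.2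
    have e1 : ∫ d in {d | ∀ k, p.2 ≤ (d k 0).1}, F (insertFirst i p d) ∂μ =
        Complex.exp (-z * p.1) * (Complex.exp (-(Λ + z) * p.2) * ∫ d, F' d ∂μ) := by
      rw [setIntegral_dataLaw_le hrate hp.2 (f := fun d => F (insertFirst i p d)) (by fun_prop),
        integral_congr_ae (g := fun d => Complex.exp (-z * (p.1 + p.2 : ℝ)) * F' d)
          (by filter_upwards [h3] with d hd using hd p hp.1 hp.2), integral_const_mul,
        ← mul_assoc, ← mul_assoc, ← Complex.exp_add, ← Complex.exp_add]
      congr 2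
      rw [Complex.ofReal_add]
      ring
    -- The law conditioned on preemption is not a delayed copy, so its contribution is found by
    -- subtracting this one from the full integral.
    have e2 : ∫ d in {d | ∀ k, p.2 ≤ (d k 0).1}, F d ∂μ =
        Complex.exp (-(Λ + z) * p.2) * ∫ d, F d ∂μ := by
      rw [setIntegral_dataLaw_le hrate hp.2 hF,
        integral_congr_ae (g := fun d => Complex.exp (-z * (p.2 : ℝ)) * F d)
          (by filter_upwards [h2] with d hd using hd p.2 hp.2), integral_const_mul,
        ← mul_assoc, ← Complex.exp_add]
      congr 2
      ring
    have e3 : ∫ d in {d | ∀ k, p.2 ≤ (d k 0).1}ᶜ, F (insertFirst i p d) ∂μ =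
        Complex.exp (-z * p.1) * ∫ d in {d | ∀ k, p.2 ≤ (d k 0).1}ᶜ, F d ∂μ := by
      rw [← integral_const_mul]
      refine setIntegral_congr_ae hms.compl ?_
      filter_upwards [h1] with d hd hd'
      exact hd p hp.1 hp.2 i (Or.inr (by simpa using hd'))
    have e4 := integral_add_compl hms (hint μ)
    rw [e2] at e4
    rw [← integral_add_compl hms (hintj i p), e1, e3, eq_sub_of_add_eq' e4]
    ring
  have hexp : ∫ x, Complex.exp (-z * (x : ℂ)) ∂expMeasure Λ = Λ / (Λ + z) :=
    integral_cexp_expMeasure hpos hz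
  have hfst : ∫ p : ℝ × ℝ, Complex.exp (-z * p.1) ∂κ = Λ / (Λ + z) := by
    rw [← hexp, hκ]
    simpa using integral_prod_mul (μ := expMeasure Λ) (ν := σ)
      (fun x : ℝ => Complex.exp (-z * (x : ℂ))) (fun _ => (1 : ℂ))
  have hboth : ∫ p : ℝ × ℝ, Complex.exp (-z * p.1) * Complex.exp (-(Λ + z) * p.2) ∂κ =
      Λ / (Λ + z) * laplace σ (Λ + z) := by
    rw [← hexp, hκ, laplace]
    exact integral_prod_mul (μ := expMeasure Λ) (ν := σ)
      (fun x : ℝ => Complex.exp (-z * (x : ℂ))) (fun s : ℝ => Complex.exp (-(Λ + z) * (s : ℂ)))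
  have hexpint : Integrable (fun p : ℝ × ℝ => Complex.exp (-z * p.1)) κ := by
    refine Integrable.of_bound (by fun_prop) 1 ?_
    filter_upwards [ae_firstPoint hσ Λ] with p hp
    rw [Complex.norm_exp]
    simpa using mul_nonneg hz hp.1.le
  have hexpint2 : Integrable (fun p : ℝ × ℝ => Complex.exp (-z * p.1) *
      Complex.exp (-(Λ + z) * p.2)) κ := by
    refine Integrable.of_bound (by fun_prop) 1 ?_
    filter_upwards [ae_firstPoint hσ Λ] with p hp
    rw [← Complex.exp_add, Complex.norm_exp]
    have := mul_nonneg hz hp.1.le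
    have := mul_nonneg (add_nonneg hpos.le hz) hp.2
    simp only [Real.exp_le_one_iff, Complex.add_re, Complex.mul_re, Complex.neg_re,
      Complex.ofReal_re, Complex.ofReal_im, mul_zero, sub_zero]
    linarith
  have hi' : ∫ p, ∫ d, F (insertFirst i p d) ∂μ ∂κ = Λ / (Λ + z) * ∫ d, F d ∂μ +
      Λ / (Λ + z) * laplace σ (Λ + z) * (∫ d, F' d ∂μ - ∫ d, F d ∂μ) := by
    rw [hi, ← hboth, ← hfst, ← integral_mul_const, ← integral_mul_const, ← integral_add]
    · simp only [mul_assoc]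
    · exact hexpint.mul_const _
    · exact hexpint2.mul_const _
  have hne' : ∀ j, j ≠ i → ∫ p, ∫ d, F (insertFirst j p d) ∂μ ∂κ =
      Λ / (Λ + z) * ∫ d, F d ∂μ := by
    intro j hj
    rw [hne j hj, integral_mul_const, hfst]
  have htot : ∑ j, ((rate j / Λ : ℝ) : ℂ) = 1 := by
    rw [← Complex.ofReal_sum, ← Finset.sum_div, ← hΛ, div_self hpos.ne', Complex.ofReal_one]
  have hfinal : ∫ d, F d ∂μ = Λ / (Λ + z) * ∫ d, F d ∂μ + ((rate i / Λ : ℝ) : ℂ) *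
      (Λ / (Λ + z) * laplace σ (Λ + z) * (∫ d, F' d ∂μ - ∫ d, F d ∂μ)) := by
    conv_lhs => rw [hdecomp]
    have : ∀ j, ((rate j / Λ : ℝ) : ℂ) * ∫ p, ∫ d, F (insertFirst j p d) ∂μ ∂κ =
        ((rate j / Λ : ℝ) : ℂ) * (Λ / (Λ + z) * ∫ d, F d ∂μ) + if j = i then
          ((rate i / Λ : ℝ) : ℂ) * (Λ / (Λ + z) * laplace σ (Λ + z) *
            (∫ d, F' d ∂μ - ∫ d, F d ∂μ)) else 0 := by
      intro j
      by_cases hj : j = i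
      · subst hj; rw [hi', if_pos rfl, mul_add]
      · rw [hne' j hj, if_neg hj, add_zero]
    simp_rw [this]
    rw [Finset.sum_add_distrib, ← Finset.sum_mul, htot, one_mul]
    simp
  have hz0 : (Λ : ℂ) + z ≠ 0 := fun h => by
    have := congrArg Complex.re h
    simp at this; linarith
  have hΛ0 : (Λ : ℂ) ≠ 0 := by exact_mod_cast hpos.ne'
  push_cast at hfinal
  generalize ∫ d, F d ∂μ = A at *
  generalize ∫ d, F' d ∂μ = B at *
  field_simp at hfinal
  linear_combination hfinal

end

/-! ### Measurability, and existence of a received update. -/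

section

variable {N : ℕ}

@[fun_prop]
theorem measurable_arrival (j : Fin N) (n : ℕ) : Measurable (arrival gap j n) := by
  unfold arrival gap; fun_prop

@[fun_prop]
theorem measurable_service (j : Fin N) (n : ℕ) : Measurable (service j n) := by
  unfold service; fun_prop

theorem measurableSet_received (i : Fin N) (n : ℕ) :
    MeasurableSet {d : Fin N → ℕ → ℝ × ℝ | Received gap service i d n} := by
  simp only [Received, ofPred_forall]
  refine MeasurableSet.iInter fun j => MeasurableSet.iInter fun m => ?_
  exact ((measurableSet_lt (measurable_arrival i n) (measurable_arrival j m)).inter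
    (measurableSet_lt (measurable_arrival j m)
      ((measurable_arrival i n).add (measurable_service i n)))).compl

section Nth

variable {α : Type*} [MeasurableSpace α] {p : α → ℕ → Prop}

theorem measurable_count (hp : ∀ n, MeasurableSet {x | p x n}) (n : ℕ) :
    Measurable fun x => @Nat.count (p x) (Classical.decPred _) n := by
  classical
  induction n with
  | zero => simp
  | succ n ih =>
    simp_rw [Nat.count_succ]
    exact ih.add (Measurable.ite (hp n) measurable_const measurable_const)

theorem measurable_nth (hp : ∀ n, MeasurableSet {x | p x n}) (k : ℕ) :
    Measurable fun x => Nat.nth (p x) k := by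
  classical
  refine measurable_to_countable' fun n => ?_
  have hm : ∀ m, MeasurableSet {x | p x m ∧ @Nat.count (p x) (Classical.decPred _) m = k} :=
    fun m => (hp m).inter (measurable_count hp m (measurableSet_singleton k))
  have hex : MeasurableSet {x | ∃ m, p x m ∧ @Nat.count (p x) (Classical.decPred _) m = k} := by
    rw [ofPred_exists]; exact MeasurableSet.iUnion hm
  -- The second set of the union accounts for the default value 0 of `Nat.nth` when there is no
  -- index of rank k.
  have : (fun x => Nat.nth (p x) k) ⁻¹' {n} =
      {x | p x n ∧ @Nat.count (p x) (Classical.decPred _) n = k} ∪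
      ({x | ∃ m, p x m ∧ @Nat.count (p x) (Classical.decPred _) m = k}ᶜ ∩ {_x | n = 0}) := by
    ext x
    simp only [mem_preimage, mem_singleton_iff, mem_union, mem_ofPred_eq, mem_inter_iff,
      mem_compl_iff]
    by_cases h : ∃ m, p x m ∧ @Nat.count (p x) (Classical.decPred _) m = k
    · obtain ⟨m, hpm, rfl⟩ := h
      have hn : Nat.nth (p x) (@Nat.count (p x) (Classical.decPred _) m) = m :=
        @Nat.nth_count _ (Classical.decPred _) _ hpm
      constructor
      · rintro rfl
        rw [hn]
        exact Or.inl ⟨hpm, rfl⟩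
      · rintro (⟨h1, h2⟩ | ⟨h1, -⟩)
        · rw [← h2, @Nat.nth_count _ (Classical.decPred _) _ h1]
        · exact (h1 ⟨m, hpm, rfl⟩).elim
    · have h0 : Nat.nth (p x) k = 0 := by
        by_contra hne
        have hlt := fun hf => Nat.lt_card_toFinset_of_nth_ne_zero hne hf
        exact h ⟨_, Nat.nth_mem k hlt, @Nat.count_nth _ (Classical.decPred _) k hlt⟩
      rw [h0]
      constructor
      · rintro rfl; exact Or.inr ⟨h, rfl⟩
      · rintro (⟨h1, h2⟩ | ⟨-, h2⟩)
        · exact (h ⟨n, h1, h2⟩).elim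
        · exact h2.symm
  rw [this]
  exact (hm n).union (hex.compl.inter (MeasurableSet.const _))

end Nth

@[fun_prop]
theorem measurable_departure (i : Fin N) (k : ℕ) :
    Measurable fun d => departure gap service i d k := by
  cases k with
  | zero => exact measurable_const
  | succ k =>
    have h : Measurable fun q : ℕ × (Fin N → ℕ → ℝ × ℝ) =>
        arrival gap i q.1 q.2 + service i q.1 q.2 :=
      measurable_from_prod_countable_right fun n =>
        (measurable_arrival i n).add (measurable_service i n)
    exact h.comp ((measurable_nth (fun n => measurableSet_received i n) k).prodMk measurable_id)

variable {rate : Fin N → ℝ} {σ : Measure ℝ} [IsProbabilityMeasure σ]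

theorem laplace_ofReal_ne_zero (hσ : σ (Iio 0) = 0) {a : ℝ} (ha : 0 ≤ a) :
    laplace σ a ≠ 0 := by
  have h0 : ∀ᵐ x ∂σ, 0 ≤ x := by
    rw [ae_iff]; simpa [Iio] using hσ
  have h1 : laplace σ a = ((∫ x, Real.exp (-a * x) ∂σ : ℝ) : ℂ) := by
    rw [laplace, ← integral_complex_ofReal]
    refine integral_congr_ae (ae_of_all _ fun x => ?_)
    push_cast; rfl
  have hint : Integrable (fun x => Real.exp (-a * x)) σ := by
    refine Integrable.of_bound (by fun_prop) 1 ?_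
    filter_upwards [h0] with x hx
    simpa using mul_nonneg ha hx
  rw [h1, Complex.ofReal_ne_zero]
  exact (integral_exp_pos hint).ne'

/-- At z = 0 the first-step identity says that rate i · L_S(Λ) times the difference of the two means
vanishes, and that factor is nonzero. -/
theorem integral_eq_of_firstStep_const (hrate : ∀ j, 0 < rate j) (hσ : σ (Iio 0) = 0) (i : Fin N)
    {F F' : (Fin N → ℕ → ℝ × ℝ) → ℂ} (hF : Measurable F) (hb : ∀ d, ‖F d‖ ≤ 1)
    (h1 : ∀ᵐ d ∂dataLaw rate σ, ∀ p : ℝ × ℝ, 0 < p.1 → 0 ≤ p.2 → ∀ j,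
      (j ≠ i ∨ ∃ k, (d k 0).1 < p.2) → F (insertFirst j p d) = F d)
    (h2 : ∀ᵐ d ∂dataLaw rate σ, ∀ s : ℝ, 0 ≤ s → F (delay (fun _ => s) d) = F d)
    (h3 : ∀ᵐ d ∂dataLaw rate σ, ∀ p : ℝ × ℝ, 0 < p.1 → 0 ≤ p.2 →
      F (insertFirst i p (delay (fun _ => p.2) d)) = F' d) :
    ∫ d, F d ∂dataLaw rate σ = ∫ d, F' d ∂dataLaw rate σ := by
  have h := integral_eq_of_firstStep hrate hσ i (z := 0) (F' := F') le_rfl hF hb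
    (by simpa using h1) (by simpa using h2) (by simpa using h3)
  rw [zero_mul, add_zero, eq_comm, mul_eq_zero] at h
  refine (sub_eq_zero.1 (h.resolve_left (mul_ne_zero ?_ ?_))).symm
  · exact_mod_cast (hrate i).ne'
  · exact laplace_ofReal_ne_zero hσ (Finset.sum_nonneg fun k _ => (hrate k).le)

/-- The indicator of this event ignores delays and failed insertions and becomes 1 after a
successful one, so its mean is that of the constant 1. -/
theorem ae_exists_received (hrate : ∀ j, 0 < rate j) (hσ : σ (Iio 0) = 0) (i : Fin N) :
    ∀ᵐ d ∂dataLaw rate σ, ∃ n, Received gap service i d n := by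
  have := isProbabilityMeasure_dataLaw (σ := σ) hrate
  set Q := {d : Fin N → ℕ → ℝ × ℝ | ∃ n, Received gap service i d n} with hQ
  have hms : MeasurableSet Q := by
    rw [hQ, ofPred_exists]; exact MeasurableSet.iUnion fun n => measurableSet_received i n
  have hreg := ae_dataLaw_pos hrate hσ
  have hcongr : ∀ d d' : Fin N → ℕ → ℝ × ℝ, (d ∈ Q ↔ d' ∈ Q) →
      Q.indicator (fun _ => (1 : ℂ)) d = Q.indicator (fun _ => (1 : ℂ)) d' := by
    intro d d' h
    by_cases hd : d ∈ Q
    · rw [indicator_of_mem hd, indicator_of_mem (h.1 hd)]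
    · rw [indicator_of_notMem hd, indicator_of_notMem (mt h.2 hd)]
  have h := integral_eq_of_firstStep_const hrate hσ i (F := Q.indicator fun _ => 1)
    (F' := fun _ => 1) (measurable_const.indicator hms)
    (fun d => by by_cases hd : d ∈ Q <;> simp [hd])
    (by
      filter_upwards [hreg] with d hd p hp1 hp2 j hj
      refine hcongr _ _ ?_
      by_cases hji : j = i
      · subst hji
        have h0 : ¬ Received gap service j (insertFirst j p d) 0 := by
          rw [received_insertFirst_zero hd]
          push Not
          simpa using hj
        refine ⟨fun ⟨n, hn⟩ => ?_, fun ⟨n, hn⟩ => ⟨n + 1, (received_insertFirst_succ hd).2 hn⟩⟩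
        cases n with
        | zero => exact (h0 hn).elim
        | succ n => exact ⟨n, (received_insertFirst_succ hd).1 hn⟩
      · exact exists_congr fun n => received_insertFirst_of_ne hd hji)
    (by
      refine ae_of_all _ fun d s hs => hcongr _ _ ?_
      exact exists_congr fun n => received_delay)
    (by
      filter_upwards [hreg] with d hd p hp1 hp2
      refine indicator_of_mem (show _ ∈ Q from ⟨0, ?_⟩) _
      refine (received_insertFirst_zero (Regular.delay hd hp2)).2 fun k => ?_
      rw [gap_delay_zero]
      have := (hd k 0).1
      linarith)
  rw [integral_indicator hms] at h
  simp only [integral_const, measureReal_restrict_apply_univ, probReal_univ, one_smul,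
    Complex.real_smul, mul_one, Complex.ofReal_eq_one] at h
  exact (prob_compl_eq_zero_iff hms).2 ((ENNReal.toReal_eq_one_iff _).1 h)

end

/-! ### Independence of past and future, and stationarity in time. -/

section

variable {N : ℕ}

/-- The points before time `u` are the same. -/
def SameBefore (u : ℝ) (d d' : Fin N → ℕ → ℝ × ℝ) : Prop :=
  ∀ j m, (arrival gap j m d < u ∨ arrival gap j m d' < u) →
    arrival gap j m d = arrival gap j m d' ∧ service j m d = service j m d'

/-- An event which depends on the points before time `u` only. -/
def DependsBefore (u : ℝ) (A : Set (Fin N → ℕ → ℝ × ℝ)) : Prop :=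
  ∀ d d', Regular d → Regular d' → SameBefore u d d' → (d ∈ A ↔ d' ∈ A)

/-- A family of events which depend on the points after a time `u` and on their position relative
to `u` only. -/
structure ShiftCovariant (B : ℝ → Set (Fin N → ℕ → ℝ × ℝ)) : Prop where
  measurableSet : ∀ u, MeasurableSet (B u)
  insertFirst_mem : ∀ {j p d u}, Regular d → 0 < p.1 → 0 ≤ p.2 → p.1 < u →
    (insertFirst j p d ∈ B u ↔ d ∈ B (u - p.1))
  delay_mem : ∀ {d u}, Regular d → 0 ≤ u → (delay (fun _ => u) d ∈ B u ↔ d ∈ B 0)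

theorem ShiftCovariant.compl {B : ℝ → Set (Fin N → ℕ → ℝ × ℝ)} (hB : ShiftCovariant B) :
    ShiftCovariant fun u => (B u)ᶜ :=
  ⟨fun u => (hB.measurableSet u).compl, fun h1 h2 h3 h4 => not_congr (hB.insertFirst_mem h1 h2 h3 h4),
    fun h1 h2 => not_congr (hB.delay_mem h1 h2)⟩

theorem SameBefore.insertFirst {u : ℝ} {j : Fin N} {p : ℝ × ℝ} {d d' : Fin N → ℕ → ℝ × ℝ}
    (h : SameBefore (u - p.1) d d') : SameBefore u (insertFirst j p d) (insertFirst j p d') := by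
  intro k m hkm
  by_cases hk : k = j
  · subst hk
    cases m with
    | zero => simp [arrival_insertFirst_zero, service_insertFirst_zero]
    | succ m =>
      rw [arrival_insertFirst_succ, arrival_insertFirst_succ] at hkm ⊢
      rw [service_insertFirst_succ, service_insertFirst_succ]
      have := h k m (hkm.imp (fun h => by linarith) fun h => by linarith)
      exact ⟨by rw [this.1], this.2⟩
  · rw [arrival_insertFirst_of_ne hk, arrival_insertFirst_of_ne hk] at hkm ⊢
    rw [service_insertFirst_of_ne hk, service_insertFirst_of_ne hk]
    have := h k m (hkm.imp (fun h => by linarith) fun h => by linarith)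
    exact ⟨by rw [this.1], this.2⟩

theorem DependsBefore.insertFirst {u : ℝ} {A : Set (Fin N → ℕ → ℝ × ℝ)} (hA : DependsBefore u A)
    {j : Fin N} {p : ℝ × ℝ} (h1 : 0 < p.1) (h2 : 0 ≤ p.2) :
    DependsBefore (u - p.1) ((fun d => MG11.insertFirst j p d) ⁻¹' A) :=
  fun _ _ hd hd' h => hA _ _ (hd.insertFirst h1 h2 j) (hd'.insertFirst h1 h2 j) h.insertFirst

variable {rate : Fin N → ℝ} {σ : Measure ℝ} [IsProbabilityMeasure σ]

theorem measurable_dataLaw_insertFirst (hrate : ∀ j, 0 < rate j) (j : Fin N)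
    {E : Set (Fin N → ℕ → ℝ × ℝ)} (hE : MeasurableSet E) :
    Measurable fun p => dataLaw rate σ ((fun d => insertFirst j p d) ⁻¹' E) := by
  have := isProbabilityMeasure_dataLaw (σ := σ) hrate
  exact measurable_measure_prodMk_left
    ((measurable_insertFirst j : Measurable fun q : (ℝ × ℝ) × (Fin N → ℕ → ℝ × ℝ) =>
      insertFirst j q.1 q.2) hE)

/-- If some point falls before u, so does the earliest one; this is the decomposition by the first
point cut down to that event. -/
theorem dataLaw_inter_compl (hrate : ∀ j, 0 < rate j) (hσ : σ (Iio 0) = 0) (i : Fin N) (u : ℝ)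
    {E : Set (Fin N → ℕ → ℝ × ℝ)} (hE : MeasurableSet E) :
    dataLaw rate σ (E ∩ {d | ∀ k, u ≤ (d k 0).1}ᶜ) =
      ∑ j, ENNReal.ofReal (rate j / ∑ k, rate k) *
        ∫⁻ p in {p | p.1 < u}, dataLaw rate σ ((fun d => insertFirst j p d) ⁻¹' E)
          ∂(expMeasure (∑ k, rate k)).prod σ := by
  have hpos : 0 < ∑ k, rate k := Finset.sum_pos (fun k _ => hrate k) ⟨i, Finset.mem_univ i⟩
  have : IsProbabilityMeasure (expMeasure (∑ k, rate k)) := isProbabilityMeasure_expMeasure hpos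
  have := isProbabilityMeasure_dataLaw (σ := σ) hrate
  have hms := hE.inter (measurableSet_forall_le_gap (N := N) u).compl
  conv_lhs => rw [dataLaw_eq_sum hrate hσ i]
  rw [Measure.finsetSum_apply]
  refine Finset.sum_congr rfl fun j _ => ?_
  rw [Measure.smul_apply, smul_eq_mul, Measure.map_apply (by fun_prop) hms,
    Measure.prod_apply (measurable_insertFirst j hms),
    ← lintegral_indicator (measurableSet_lt measurable_fst measurable_const)]
  congr 1
  refine lintegral_congr_ae ?_
  filter_upwards [ae_firstPoint hσ (∑ k, rate k)] with p hp
  by_cases hpu : p.1 < u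
  · rw [indicator_of_mem (show p ∈ {p : ℝ × ℝ | p.1 < u} from hpu)]
    congr 1
    ext d
    refine ⟨fun h => h.1, fun h => ⟨h, fun h' => ?_⟩⟩
    have := h' j
    simp only [insertFirst, if_true, srcCons] at this
    linarith
  · rw [indicator_of_notMem (show p ∉ {p : ℝ × ℝ | p.1 < u} from hpu)]
    refine (measure_eq_zero_iff_ae_notMem).2 ?_
    filter_upwards [ae_dataLaw_pos hrate hσ] with d hd hmem
    refine hmem.2 fun k => ?_
    have hr : Regular d := hd
    have h1 := (hr k 0).1
    push Not at hpu
    by_cases hk : k = j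
    · simpa [insertFirst, hk, srcCons] using hpu
    · simp only [insertFirst, hk, if_false, srcDelay]
      linarith

/-- The points before u are removed one at a time. With none left, the product formula is exact;
otherwise the first one is deleted and u decreases. Each removal costs a factor at most Pr(Exp(Λ) <
U), with U fixed so that the factor is uniform in u, and the trivial bound 1 starts the induction.
-/
theorem dataLaw_inter_le_pow (hrate : ∀ j, 0 < rate j) (hσ : σ (Iio 0) = 0) (i : Fin N) (U : ℝ)
    {B : ℝ → Set (Fin N → ℕ → ℝ × ℝ)} (hB : ShiftCovariant B) (n : ℕ) :
    ∀ u, 0 ≤ u → u ≤ U → ∀ A, MeasurableSet A → DependsBefore u A →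
      dataLaw rate σ (A ∩ B u) ≤ dataLaw rate σ A * dataLaw rate σ (B 0) +
        (expMeasure (∑ k, rate k) (Iio U)) ^ n := by
  have hpos : 0 < ∑ k, rate k := Finset.sum_pos (fun k _ => hrate k) ⟨i, Finset.mem_univ i⟩
  have : IsProbabilityMeasure (expMeasure (∑ k, rate k)) := isProbabilityMeasure_expMeasure hpos
  have := isProbabilityMeasure_dataLaw (σ := σ) hrate
  have hreg := ae_dataLaw_pos hrate hσ
  induction n with
  | zero =>
    intro u _ _ A _ _
    rw [pow_zero]
    exact prob_le_one.trans le_add_self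
  | succ n ih =>
    intro u hu huU A hA hAu
    have hC := measurableSet_forall_le_gap (N := N) u
    have hBu := hB.measurableSet u
    set q := expMeasure (∑ k, rate k) (Iio U) with hq
    -- All regular paths without points before u agree before u, so A contains all of them or none;
    -- memorylessness then handles `B u`.
    have e1 : dataLaw rate σ (A ∩ B u ∩ {d | ∀ k, u ≤ (d k 0).1}) =
        dataLaw rate σ (A ∩ {d | ∀ k, u ≤ (d k 0).1}) * dataLaw rate σ (B 0) := by
      by_cases hex : ∃ d, Regular d ∧ d ∈ A ∧ ∀ k, u ≤ (d k 0).1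
      · obtain ⟨d, hd, hdA, hdu⟩ := hex
        have hsub : ∀ d', Regular d' → (∀ k, u ≤ (d' k 0).1) → d' ∈ A := by
          intro d' hd' hdu'
          refine (hAu d d' hd hd' fun j m hjm => ?_).1 hdA
          have h1 := hd.gap_le_arrival j m
          have h2 := hd'.gap_le_arrival j m
          have h3 := hdu j
          have h4 := hdu' j
          rcases hjm with h | h <;> linarith
        have f1 : dataLaw rate σ (A ∩ {d | ∀ k, u ≤ (d k 0).1}) =
            dataLaw rate σ {d | ∀ k, u ≤ (d k 0).1} := by
          refine measure_congr ?_
          filter_upwards [hreg] with d' hd'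
          exact propext ⟨fun h => h.2, fun h => ⟨hsub d' hd' h, h⟩⟩
        have f2 : dataLaw rate σ (A ∩ B u ∩ {d | ∀ k, u ≤ (d k 0).1}) =
            dataLaw rate σ (B u ∩ {d | ∀ k, u ≤ (d k 0).1}) := by
          refine measure_congr ?_
          filter_upwards [hreg] with d' hd'
          exact propext ⟨fun h => ⟨h.1.2, h.2⟩, fun h => ⟨⟨hsub d' hd' h.2, h.1⟩, h.2⟩⟩
        have f3 : dataLaw rate σ ((delay fun _ => u) ⁻¹' B u) = dataLaw rate σ (B 0) := by
          refine measure_congr ?_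
          filter_upwards [hreg] with d' hd'
          exact propext (hB.delay_mem hd' hu)
        have f4 := congrArg (fun ν => ν univ) (restrict_dataLaw_le (σ := σ) hrate hu)
        simp only [Measure.restrict_apply_univ, Measure.smul_apply,
          Measure.map_apply (by fun_prop : Measurable (delay fun _ : Fin N => u)) MeasurableSet.univ,
          preimage_univ, measure_univ, smul_eq_mul, mul_one] at f4
        rw [f1, f2, ← Measure.restrict_apply hBu, restrict_dataLaw_le hrate hu,
          Measure.smul_apply, Measure.map_apply (by fun_prop) hBu, f3, f4, smul_eq_mul]
      · have h0 : dataLaw rate σ (A ∩ {d | ∀ k, u ≤ (d k 0).1}) = 0 := by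
          refine (measure_eq_zero_iff_ae_notMem).2 ?_
          filter_upwards [hreg] with d hd hmem
          exact hex ⟨d, hd, hmem.1, hmem.2⟩
        rw [h0, zero_mul]
        exact measure_mono_null (inter_subset_inter_left _ inter_subset_left) h0
    have e2 : dataLaw rate σ (A ∩ B u ∩ {d | ∀ k, u ≤ (d k 0).1}ᶜ) ≤
        dataLaw rate σ (A ∩ {d | ∀ k, u ≤ (d k 0).1}ᶜ) * dataLaw rate σ (B 0) + q ^ (n + 1) := by
      rw [dataLaw_inter_compl hrate hσ i u (hA.inter hBu), dataLaw_inter_compl hrate hσ i u hA]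
      have hj : ∀ j, ∫⁻ p in {p | p.1 < u},
            dataLaw rate σ ((fun d => insertFirst j p d) ⁻¹' (A ∩ B u))
              ∂(expMeasure (∑ k, rate k)).prod σ ≤
          (∫⁻ p in {p | p.1 < u}, dataLaw rate σ ((fun d => insertFirst j p d) ⁻¹' A)
              ∂(expMeasure (∑ k, rate k)).prod σ) * dataLaw rate σ (B 0) + q ^ (n + 1) := by
        intro j
        have hmu : MeasurableSet {p : ℝ × ℝ | p.1 < u} :=
          measurableSet_lt measurable_fst measurable_const
        have hmeas := measurable_dataLaw_insertFirst (σ := σ) hrate j hA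
        have hqu : ((expMeasure (∑ k, rate k)).prod σ) {p | p.1 < u} ≤ q := by
          have : {p : ℝ × ℝ | p.1 < u} = Iio u ×ˢ univ := by ext; simp
          rw [this, Measure.prod_prod, measure_univ, mul_one]
          exact measure_mono (Iio_subset_Iio huU)
        calc _ ≤ ∫⁻ p in {p | p.1 < u}, (dataLaw rate σ ((fun d => insertFirst j p d) ⁻¹' A) *
                dataLaw rate σ (B 0) + q ^ n) ∂(expMeasure (∑ k, rate k)).prod σ := by
              refine setLIntegral_mono_ae ((hmeas.mul_const _).add_const _).aemeasurable ?_
              filter_upwards [ae_firstPoint hσ (∑ k, rate k)] with p hp hpu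
              have hpu' : p.1 < u := hpu
              have h1 : dataLaw rate σ ((fun d => insertFirst j p d) ⁻¹' (A ∩ B u)) =
                  dataLaw rate σ ((fun d => insertFirst j p d) ⁻¹' A ∩ B (u - p.1)) := by
                refine measure_congr ?_
                filter_upwards [hreg] with d hd
                exact propext (and_congr_right fun _ => hB.insertFirst_mem hd hp.1 hp.2 hpu)
              rw [h1]
              exact ih (u - p.1) (by linarith) (by linarith [hp.1]) _
                ((by fun_prop : Measurable fun d => insertFirst j p d) hA)
                (hAu.insertFirst hp.1 hp.2)
          _ = (∫⁻ p in {p | p.1 < u}, dataLaw rate σ ((fun d => insertFirst j p d) ⁻¹' A)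
              ∂(expMeasure (∑ k, rate k)).prod σ) * dataLaw rate σ (B 0) +
              q ^ n * ((expMeasure (∑ k, rate k)).prod σ) {p | p.1 < u} := by
            rw [lintegral_add_right _ measurable_const, lintegral_mul_const _ hmeas,
              setLIntegral_const]
          _ ≤ _ := by
            rw [pow_succ]
            gcongr
      have htot : ∑ j, ENNReal.ofReal (rate j / ∑ k, rate k) = 1 := by
        rw [← ENNReal.ofReal_sum_of_nonneg fun j _ => (div_pos (hrate j) hpos).le,
          ← Finset.sum_div, div_self hpos.ne', ENNReal.ofReal_one]
      calc _ ≤ ∑ j, ENNReal.ofReal (rate j / ∑ k, rate k) *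
            ((∫⁻ p in {p | p.1 < u}, dataLaw rate σ ((fun d => insertFirst j p d) ⁻¹' A)
              ∂(expMeasure (∑ k, rate k)).prod σ) * dataLaw rate σ (B 0) + q ^ (n + 1)) := by
            gcongr with j
            exact hj j
        _ = _ := by
          simp_rw [mul_add]
          rw [Finset.sum_add_distrib, ← Finset.sum_mul, htot, one_mul, Finset.sum_mul]
          simp_rw [mul_assoc]
    rw [← measure_inter_add_sdiff (A ∩ B u) hC, ← measure_inter_add_sdiff A hC, sdiff_eq, sdiff_eq, e1,
      add_mul, add_assoc]
    gcongr

/-- What happens after time `u` is independent of what happens before, and has the same law as what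
happens after time `0`. -/
theorem dataLaw_inter_shift (hrate : ∀ j, 0 < rate j) (hσ : σ (Iio 0) = 0) (i : Fin N)
    {B : ℝ → Set (Fin N → ℕ → ℝ × ℝ)} (hB : ShiftCovariant B) {u : ℝ} (hu : 0 ≤ u)
    {A : Set (Fin N → ℕ → ℝ × ℝ)} (hA : MeasurableSet A) (hAu : DependsBefore u A) :
    dataLaw rate σ (A ∩ B u) = dataLaw rate σ A * dataLaw rate σ (B 0) := by
  have hpos : 0 < ∑ k, rate k := Finset.sum_pos (fun k _ => hrate k) ⟨i, Finset.mem_univ i⟩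
  have : IsProbabilityMeasure (expMeasure (∑ k, rate k)) := isProbabilityMeasure_expMeasure hpos
  have := isProbabilityMeasure_dataLaw (σ := σ) hrate
  have hq : expMeasure (∑ k, rate k) (Iio u) < 1 := by
    rw [← compl_Ici, prob_compl_eq_one_sub measurableSet_Ici, expMeasure_Ici hpos hu]
    exact ENNReal.sub_lt_self ENNReal.one_ne_top one_ne_zero
      (by simpa using Real.exp_pos _)
  have hle : ∀ {B : ℝ → Set (Fin N → ℕ → ℝ × ℝ)}, ShiftCovariant B →
      dataLaw rate σ (A ∩ B u) ≤ dataLaw rate σ A * dataLaw rate σ (B 0) := by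
    intro B hB
    have ht := (ENNReal.tendsto_pow_atTop_nhds_zero_of_lt_one hq).const_add
      (dataLaw rate σ A * dataLaw rate σ (B 0))
    rw [add_zero] at ht
    exact ge_of_tendsto' ht fun n =>
      dataLaw_inter_le_pow hrate hσ i u hB n u hu le_rfl A hA hAu
  -- The upper bound applied to the complements of the B's yields the lower bound.
  refine le_antisymm (hle hB) ?_
  have h1 := measure_inter_add_sdiff (μ := dataLaw rate σ) A (hB.measurableSet u)
  have h2 : dataLaw rate σ A * dataLaw rate σ (B 0) + dataLaw rate σ A * dataLaw rate σ (B 0)ᶜ =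
      dataLaw rate σ A := by
    rw [← mul_add, prob_add_prob_compl (hB.measurableSet 0), mul_one]
  have h3 := hle hB.compl
  rw [sdiff_eq] at h1
  refine (ENNReal.add_le_add_iff_right (measure_ne_top (dataLaw rate σ) (A ∩ (B u)ᶜ))).1 ?_
  rw [h1]
  calc _ ≤ _ := add_le_add_right h3 _
    _ = _ := h2

/-- Stationarity. -/
theorem dataLaw_shift (hrate : ∀ j, 0 < rate j) (hσ : σ (Iio 0) = 0) (i : Fin N)
    {B : ℝ → Set (Fin N → ℕ → ℝ × ℝ)} (hB : ShiftCovariant B) {u : ℝ} (hu : 0 ≤ u) :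
    dataLaw rate σ (B u) = dataLaw rate σ (B 0) := by
  have := isProbabilityMeasure_dataLaw (σ := σ) hrate
  simpa using dataLaw_inter_shift (σ := σ) hrate hσ i hB hu MeasurableSet.univ
    fun _ _ _ _ _ => Iff.rfl

end

/-! ### Receptions within a time window, and the age of information. -/

section

variable {N : ℕ} {i j : Fin N} {p : ℝ × ℝ} {a b u r : ℝ} {d d' : Fin N → ℕ → ℝ × ℝ}

/-- Some update of source `i` arrives, is served and departs during `[a, b]`. -/
def ReceivedWithin (i : Fin N) (a b : ℝ) (d : Fin N → ℕ → ℝ × ℝ) : Prop :=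
  ∃ n, (a ≤ arrival gap i n d ∧ arrival gap i n d ≤ b ∧
    arrival gap i n d + service i n d ≤ b) ∧ Received gap service i d n

/-- Updates of source `i` are received at arbitrarily late times. -/
def ReceivedForever (i : Fin N) (d : Fin N → ℕ → ℝ × ℝ) : Prop :=
  ∀ t : ℝ, ∃ n, t ≤ arrival gap i n d ∧ Received gap service i d n

/-- Since Q rules out the inserted update, only the delayed old updates are candidates on the left.
-/
theorem exists_received_insertFirst (hd : Regular d) {Q : ℝ → ℝ → Prop} (hQ : ¬ Q p.1 p.2) :
    (∃ n, Q (arrival gap i n (insertFirst j p d)) (service i n (insertFirst j p d)) ∧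
      Received gap service i (insertFirst j p d) n) ↔
    ∃ n, Q (p.1 + arrival gap i n d) (service i n d) ∧ Received gap service i d n := by
  by_cases hj : j = i
  · subst hj
    constructor
    · rintro ⟨n, hn, hr⟩
      cases n with
      | zero => rw [arrival_insertFirst_zero, service_insertFirst_zero] at hn; exact (hQ hn).elim
      | succ n =>
        rw [arrival_insertFirst_succ, service_insertFirst_succ] at hn
        exact ⟨n, hn, (received_insertFirst_succ hd).1 hr⟩
    · rintro ⟨n, hn, hr⟩
      refine ⟨n + 1, ?_, (received_insertFirst_succ hd).2 hr⟩
      rwa [arrival_insertFirst_succ, service_insertFirst_succ]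
  · refine exists_congr fun n => ?_
    rw [arrival_insertFirst_of_ne (Ne.symm hj), service_insertFirst_of_ne (Ne.symm hj),
      received_insertFirst_of_ne hd hj]

theorem receivedWithin_insertFirst (hd : Regular d) (h : p.1 < a) :
    ReceivedWithin i a b (insertFirst j p d) ↔ ReceivedWithin i (a - p.1) (b - p.1) d := by
  refine (exists_received_insertFirst hd (Q := fun x s => a ≤ x ∧ x ≤ b ∧ x + s ≤ b)
    fun hQ => by linarith [hQ.1]).trans (exists_congr fun n => and_congr_left fun _ => ?_)
  rw [sub_le_iff_le_add', le_sub_iff_add_le', le_sub_iff_add_le', add_assoc]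

theorem receivedWithin_delay :
    ReceivedWithin i a b (delay (fun _ => r) d) ↔ ReceivedWithin i (a - r) (b - r) d := by
  refine exists_congr fun n => ?_
  rw [received_delay, arrival_delay, service_delay, sub_le_iff_le_add', le_sub_iff_add_le',
    le_sub_iff_add_le', add_assoc]

theorem measurableSet_receivedWithin_prod (i : Fin N) {f g : ℝ → ℝ} (hf : Measurable f)
    (hg : Measurable g) :
    MeasurableSet {q : (Fin N → ℕ → ℝ × ℝ) × ℝ | ReceivedWithin i (f q.2) (g q.2) q.1} := by
  simp only [ReceivedWithin, ofPred_exists]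
  refine MeasurableSet.iUnion fun n => ?_
  have ha := (measurable_arrival i n).comp
    (measurable_fst : Measurable (Prod.fst : (Fin N → ℕ → ℝ × ℝ) × ℝ → _))
  have hs := (measurable_service i n).comp
    (measurable_fst : Measurable (Prod.fst : (Fin N → ℕ → ℝ × ℝ) × ℝ → _))
  exact ((measurableSet_le (hf.comp measurable_snd) ha).inter
    ((measurableSet_le ha (hg.comp measurable_snd)).inter
      (measurableSet_le (ha.add hs) (hg.comp measurable_snd)))).inter
    (measurable_fst (measurableSet_received i n))

theorem measurableSet_receivedWithin (i : Fin N) (a b : ℝ) :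
    MeasurableSet {d : Fin N → ℕ → ℝ × ℝ | ReceivedWithin i a b d} :=
  (measurable_prodMk_right (y := (0 : ℝ)))
    (measurableSet_receivedWithin_prod i (measurable_const (a := a)) (measurable_const (a := b)))

theorem measurableSet_receivedWithin_time (i : Fin N) {f g : ℝ → ℝ} (hf : Measurable f)
    (hg : Measurable g) (d : Fin N → ℕ → ℝ × ℝ) :
    MeasurableSet {t : ℝ | ReceivedWithin i (f t) (g t) d} :=
  measurable_prodMk_left (measurableSet_receivedWithin_prod i hf hg)

theorem SameBefore.symm (h : SameBefore u d d') : SameBefore u d' d := fun j m hjm =>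
  ⟨(h j m hjm.symm).1.symm, (h j m hjm.symm).2.symm⟩

/-- An update departing by b can be preempted only by arrivals before its departure, so the points
before u decide. -/
theorem SameBefore.receivedWithin (h : SameBefore u d d') (hb : b < u) :
    ReceivedWithin i a b d ↔ ReceivedWithin i a b d' := by
  have key : ∀ {d d' : Fin N → ℕ → ℝ × ℝ}, SameBefore u d d' → ReceivedWithin i a b d →
      ReceivedWithin i a b d' := by
    rintro d d' h ⟨n, ⟨h1, h2, h3⟩, hr⟩
    obtain ⟨e1, e2⟩ := h i n (Or.inl (h2.trans_lt hb))
    rw [e1] at h1 h2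
    rw [e1, e2] at h3
    refine ⟨n, ⟨h1, h2, h3⟩, fun k m hkm => hr k m ?_⟩
    rw [(h k m (Or.inr (by linarith [hkm.2]))).1, e1, e2]
    exact hkm
  exact ⟨key h, key h.symm⟩

theorem shiftCovariant_receivedWithin (i : Fin N) (ha : 0 ≤ a) :
    ShiftCovariant fun u => {d : Fin N → ℕ → ℝ × ℝ | ReceivedWithin i (u + a) (u + b) d} where
  measurableSet u := measurableSet_receivedWithin i _ _
  insertFirst_mem {j p d u} hd _ _ hu := by
    refine (receivedWithin_insertFirst hd (by linarith)).trans ?_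
    rw [add_sub_right_comm, add_sub_right_comm]; rfl
  delay_mem {d u} _ _ := by
    refine receivedWithin_delay.trans ?_
    rw [add_sub_right_comm, add_sub_right_comm, sub_self]; rfl

theorem shiftCovariant_exists_received (i : Fin N) :
    ShiftCovariant fun u => {d : Fin N → ℕ → ℝ × ℝ |
      ∃ n, u ≤ arrival gap i n d ∧ Received gap service i d n} where
  measurableSet u := by
    rw [ofPred_exists]
    exact MeasurableSet.iUnion fun n =>
      (measurableSet_le measurable_const (measurable_arrival i n)).inter (measurableSet_received i n)
  insertFirst_mem {j p d u} hd _ _ hu := by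
    refine (exists_received_insertFirst hd (Q := fun x _ => u ≤ x) (not_le.2 hu)).trans ?_
    exact exists_congr fun n => and_congr_left fun _ => sub_le_iff_le_add'.symm
  delay_mem {d u} _ _ := by
    refine exists_congr fun n => ?_
    rw [received_delay, arrival_delay, le_add_iff_nonneg_right]

theorem ReceivedForever.infinite (h : ReceivedForever i d) :
    (Set.ofPred (Received gap service i d)).Infinite := by
  intro hfin
  obtain ⟨M, hM⟩ := (hfin.image fun n => arrival gap i n d).bddAbove
  obtain ⟨n, hn, hr⟩ := h (M + 1)
  have := hM ⟨n, hr, rfl⟩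
  simp only at this
  linarith

variable {rate : Fin N → ℝ} {σ : Measure ℝ} [IsProbabilityMeasure σ]

/-- By stationarity, a received update arriving after T is as certain as one arriving after 0;
integers T suffice. -/
theorem ae_receivedForever (hrate : ∀ j, 0 < rate j) (hσ : σ (Iio 0) = 0) (i : Fin N) :
    ∀ᵐ d ∂dataLaw rate σ, ReceivedForever i d := by
  have := isProbabilityMeasure_dataLaw (σ := σ) hrate
  have h0 : dataLaw rate σ {d | ∃ n, 0 ≤ arrival gap i n d ∧ Received gap service i d n} = 1 := by
    refine (prob_compl_eq_zero_iff ((shiftCovariant_exists_received i).measurableSet 0)).1 ?_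
    refine (measure_eq_zero_iff_ae_notMem).2 ?_
    filter_upwards [ae_dataLaw_pos hrate hσ, ae_exists_received hrate hσ i] with d hd hex
    have hr : Regular d := hd
    obtain ⟨n, hn⟩ := hex
    exact not_not.2 ⟨n, (hr.arrival_pos i n).le, hn⟩
  have h1 : ∀ᵐ d ∂dataLaw rate σ, ∀ T : ℕ, ∃ n, (T : ℝ) ≤ arrival gap i n d ∧
      Received gap service i d n := by
    rw [ae_all_iff]
    intro T
    have := dataLaw_shift (σ := σ) hrate hσ i (shiftCovariant_exists_received i) (Nat.cast_nonneg T)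
    rw [h0] at this
    exact (prob_compl_eq_zero_iff ((shiftCovariant_exists_received i).measurableSet T)).2 this
  filter_upwards [h1] with d hd t
  obtain ⟨T, hT⟩ := exists_nat_ge t
  obtain ⟨n, hn, hr⟩ := hd T
  exact ⟨n, hT.trans hn, hr⟩

/-- The first received update has the earliest departure among the received ones: a later arrival
cannot preempt it, hence comes after it has departed. -/
theorem Regular.departure_one_le_iff (hd : Regular d) (h : ReceivedForever i d) :
    departure gap service i d 1 ≤ b ↔ ReceivedWithin i 0 b d := by
  have hinf := h.infinite
  set n₀ := Nat.nth (Received gap service i d) 0 with hn₀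
  have hr₀ : Received gap service i d n₀ := Nat.nth_mem_of_infinite hinf 0
  have hdep : departure gap service i d 1 = arrival gap i n₀ d + service i n₀ d := rfl
  have hs : ∀ n, 0 ≤ service i n d := fun n => (hd i n).2
  rw [hdep]
  constructor
  · intro hle
    exact ⟨n₀, ⟨(hd.arrival_pos i n₀).le, by linarith [hs n₀], hle⟩, hr₀⟩
  · rintro ⟨n, ⟨-, -, h3⟩, hr⟩
    have hle : n₀ ≤ n := by
      rw [hn₀, Nat.nth_zero]; exact Nat.sInf_le hr
    rcases hle.eq_or_lt with h | h
    · rw [h]; exact h3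
    · have h1 := hd.arrival_strictMono i h
      have h2 := hr₀ i n
      have h4 : arrival gap i n₀ d + service i n₀ d ≤ arrival gap i n d := by
        by_contra hcon
        exact h2 ⟨h1, not_le.1 hcon⟩
      linarith [hs n]

theorem Regular.recvArrival_mono (hd : Regular d) (h : ReceivedForever i d) :
    Monotone (recvArrival gap service i d) := by
  refine monotone_nat_of_le_succ fun k => ?_
  cases k with
  | zero => exact (hd.arrival_pos i _).le
  | succ k => exact (hd.arrival_strictMono i).monotone (Nat.nth_monotone h.infinite (Nat.le_succ k))

theorem Regular.recvArrival_le_departure (hd : Regular d) (k : ℕ) :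
    recvArrival gap service i d k ≤ departure gap service i d k := by
  cases k with
  | zero => exact le_rfl
  | succ k => exact le_add_of_nonneg_right (hd i _).2

/-- Needed for `lastIndex` to be a genuine maximum, as `sSup` of an unbounded set of naturals is 0.
-/
theorem Regular.bddAbove_departure_le (hd : Regular d) (h : ReceivedForever i d) (t : ℝ) :
    BddAbove {k : ℕ | departure gap service i d k ≤ t} := by
  classical
  obtain ⟨n, hn, hr⟩ := h (t + 1)
  refine ⟨Nat.count (Received gap service i d) n, fun k hk => ?_⟩
  by_contra hcon
  push Not at hcon
  have h1 := hd.recvArrival_mono h (Nat.succ_le_of_lt hcon)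
  have h2 : recvArrival gap service i d (Nat.succ (Nat.count (Received gap service i d) n)) =
      arrival gap i n d := by
    change arrival gap i (Nat.nth _ (Nat.count _ n)) d = _
    rw [Nat.nth_count hr]
  have h3 := hd.recvArrival_le_departure (i := i) k
  have h4 : departure gap service i d k ≤ t := hk
  linarith

/-- Received updates arrive in the order of their indices, so the last one received is the freshest.
The age is therefore at most w as soon as any update received by t arrived at or after t - w. -/
theorem Regular.lt_aoi_iff (hd : Regular d) (h : ReceivedForever i d) {w t : ℝ} (hw : 0 ≤ w)
    (hwt : w < t) : w < aoi gap service i t d ↔ ¬ ReceivedWithin i (t - w) t d := by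
  classical
  have hbdd := hd.bddAbove_departure_le h t
  have hne : {k : ℕ | departure gap service i d k ≤ t}.Nonempty := ⟨0, (hw.trans hwt.le)⟩
  have hmem : departure gap service i d (lastIndex gap service i t d) ≤ t := Nat.sSup_mem hne hbdd
  rw [aoi, lt_sub_comm, ← not_le, not_iff_not]
  constructor
  · intro hle
    cases hK : lastIndex gap service i t d with
    -- With nothing received yet the age is t itself, which exceeds w by `hwt`.
    | zero =>
      rw [hK] at hle
      change t - w ≤ 0 at hle
      linarith
    | succ k =>
      rw [hK] at hle hmem
      exact ⟨_, ⟨hle, (hd.recvArrival_le_departure (k + 1)).trans hmem, hmem⟩,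
        Nat.nth_mem_of_infinite h.infinite k⟩
  · rintro ⟨n, ⟨h1, h2, h3⟩, hr⟩
    have hdep : Nat.count (Received gap service i d) n + 1 ∈
        {k : ℕ | departure gap service i d k ≤ t} := by
      change arrival gap i (Nat.nth _ (Nat.count _ n)) d +
        service i (Nat.nth _ (Nat.count _ n)) d ≤ t
      rwa [Nat.nth_count hr]
    have hle := hd.recvArrival_mono h (le_csSup hbdd hdep)
    refine h1.trans (le_trans (le_of_eq ?_) hle)
    change _ = arrival gap i (Nat.nth _ (Nat.count _ n)) d
    rw [Nat.nth_count hr]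

theorem Regular.aoi_le (hd : Regular d) (t : ℝ) : aoi gap service i t d ≤ t := by
  have : 0 ≤ recvArrival gap service i d (lastIndex gap service i t d) := by
    cases lastIndex gap service i t d with
    | zero => exact le_rfl
    | succ k => exact (hd.arrival_pos i _).le
  rw [aoi]; linarith

end

/-! ### Violation time over an interval, as a functional of the path. -/

section

variable {N : ℕ} {i : Fin N} {w u : ℝ} {d : Fin N → ℕ → ℝ × ℝ}

/-- Amount of time `v ∈ [0, t)` such that no update of source `i` arrives, is served and departs
during `[u + v, u + v + w]`. -/
noncomputable def idleTime (i : Fin N) (w u t : ℝ) (d : Fin N → ℕ → ℝ × ℝ) : ℝ :=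
  volume.real {v : ℝ | v ∈ Ico 0 t ∧ ¬ ReceivedWithin i (u + v) (u + v + w) d}

theorem measurable_idleTime (i : Fin N) (w u t : ℝ) : Measurable (idleTime i w u t) := by
  have hm : MeasurableSet {q : (Fin N → ℕ → ℝ × ℝ) × ℝ |
      q.2 ∈ Ico 0 t ∧ ¬ ReceivedWithin i (u + q.2) (u + q.2 + w) q.1} :=
    (measurable_snd measurableSet_Ico).inter
      (measurableSet_receivedWithin_prod i (f := fun v => u + v) (g := fun v => u + v + w)
        (by fun_prop) (by fun_prop)).compl
  exact (measurable_measure_prodMk_left hm).ennreal_toReal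

theorem measurableSet_idle (i : Fin N) (w u : ℝ) (d : Fin N → ℕ → ℝ × ℝ) {s : Set ℝ}
    (hs : MeasurableSet s) :
    MeasurableSet {v : ℝ | v ∈ s ∧ ¬ ReceivedWithin i (u + v) (u + v + w) d} :=
  hs.inter (measurableSet_receivedWithin_time i (f := fun v => u + v) (g := fun v => u + v + w)
    (by fun_prop) (by fun_prop) d).compl

theorem idleTime_nonneg (i : Fin N) (w u t : ℝ) (d : Fin N → ℕ → ℝ × ℝ) :
    0 ≤ idleTime i w u t d := measureReal_nonneg

theorem volume_idle_ne_top (i : Fin N) (w u t : ℝ) (d : Fin N → ℕ → ℝ × ℝ) :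
    volume {v : ℝ | v ∈ Ico 0 t ∧ ¬ ReceivedWithin i (u + v) (u + v + w) d} ≠ ∞ :=
  measure_ne_top_of_subset (fun _ hv => hv.1 : _ ⊆ Ico 0 t) (by simp)

theorem idleTime_le (i : Fin N) (w u : ℝ) {t : ℝ} (ht : 0 ≤ t) (d : Fin N → ℕ → ℝ × ℝ) :
    idleTime i w u t d ≤ t := by
  refine (measureReal_mono (fun _ hv => hv.1 : _ ⊆ Ico 0 t) (by simp)).trans ?_
  simp [ht]

theorem idleTime_mono (i : Fin N) (w u : ℝ) (d : Fin N → ℕ → ℝ × ℝ) :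
    Monotone fun t => idleTime i w u t d := fun _ t hst =>
  measureReal_mono (fun _ hv => ⟨⟨hv.1.1, hv.1.2.trans_le hst⟩, hv.2⟩)
    (volume_idle_ne_top i w u t d)

theorem idleTime_add (i : Fin N) (w u : ℝ) {s t : ℝ} (hs : 0 ≤ s) (ht : 0 ≤ t)
    (d : Fin N → ℕ → ℝ × ℝ) :
    idleTime i w u (s + t) d = idleTime i w u s d + idleTime i w (u + s) t d := by
  have hset : {v : ℝ | v ∈ Ico 0 (s + t) ∧ ¬ ReceivedWithin i (u + v) (u + v + w) d} =
      {v : ℝ | v ∈ Ico 0 s ∧ ¬ ReceivedWithin i (u + v) (u + v + w) d} ∪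
      {v : ℝ | v ∈ Ico s (s + t) ∧ ¬ ReceivedWithin i (u + v) (u + v + w) d} := by
    rw [← Ico_union_Ico_eq_Ico hs (by linarith : s ≤ s + t)]
    ext v
    exact or_and_right
  have hdisj : Disjoint {v : ℝ | v ∈ Ico 0 s ∧ ¬ ReceivedWithin i (u + v) (u + v + w) d}
      {v : ℝ | v ∈ Ico s (s + t) ∧ ¬ ReceivedWithin i (u + v) (u + v + w) d} :=
    Set.disjoint_left.2 fun v h1 h2 => absurd h1.1.2 (not_lt.2 h2.1.1)
  have hshift : volume {v : ℝ | v ∈ Ico s (s + t) ∧ ¬ ReceivedWithin i (u + v) (u + v + w) d} =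
      volume {v : ℝ | v ∈ Ico 0 t ∧ ¬ ReceivedWithin i (u + s + v) (u + s + v + w) d} := by
    rw [← measure_preimage_add volume s]
    congr 1
    ext v
    simp only [mem_preimage, mem_ofPred_eq, mem_Ico, le_add_iff_nonneg_right, add_lt_add_iff_left,
      add_assoc]
  rw [idleTime, hset, measureReal_union hdisj (measurableSet_idle i w u d measurableSet_Ico)
    (volume_idle_ne_top i w u s d)
    (measure_ne_top_of_subset (fun _ hv => hv.1 : _ ⊆ Ico s (s + t)) (by simp))]
  congr 1
  rw [measureReal_def, hshift]
  rfl

theorem shiftCovariant_idleTime (i : Fin N) (w t : ℝ) {c : ℝ} (hc : 0 ≤ c) {s : Set ℝ}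
    (hs : MeasurableSet s) :
    ShiftCovariant fun u => idleTime i w (u + c) t ⁻¹' s where
  measurableSet u := measurable_idleTime i w _ t hs
  insertFirst_mem {j p d u} hd _ _ hu := by
    have : idleTime i w (u + c) t (insertFirst j p d) = idleTime i w (u - p.1 + c) t d := by
      unfold idleTime
      congr 1
      ext v
      refine and_congr_right fun hv => not_congr ?_
      rw [receivedWithin_insertFirst hd (by linarith [hv.1])]
      ring_nf
    rw [mem_preimage, mem_preimage, this]
  delay_mem {d u} _ _ := by
    have : idleTime i w (u + c) t (delay (fun _ => u) d) = idleTime i w (0 + c) t d := by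
      unfold idleTime
      congr 1
      ext v
      refine and_congr_right fun hv => not_congr ?_
      rw [receivedWithin_delay]
      ring_nf
    rw [mem_preimage, mem_preimage, this]

end

/-! ### Time averages: the strong law over alternate blocks. -/

section

variable {N : ℕ} {rate : Fin N → ℝ} {σ : Measure ℝ} [IsProbabilityMeasure σ]

theorem dataLaw_not_receivedWithin (hrate : ∀ j, 0 < rate j) (hσ : σ (Iio 0) = 0) (i : Fin N)
    {w u : ℝ} (hu : 0 ≤ u) :
    dataLaw rate σ {d | ¬ ReceivedWithin i u (u + w) d} =
      dataLaw rate σ {d | ¬ ReceivedWithin i 0 w d} := by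
  have := dataLaw_shift (σ := σ) hrate hσ i
    (shiftCovariant_receivedWithin i (a := 0) (b := w) le_rfl).compl hu
  simp only [add_zero, zero_add] at this
  exact this

/-- Tonelli, with the same probability at every instant by stationarity. -/
theorem integral_idleTime (hrate : ∀ j, 0 < rate j) (hσ : σ (Iio 0) = 0) (i : Fin N)
    {w u t : ℝ} (hu : 0 ≤ u) (ht : 0 ≤ t) :
    ∫ d, idleTime i w u t d ∂dataLaw rate σ =
      t * (dataLaw rate σ).real {d | ¬ ReceivedWithin i 0 w d} := by
  have := isProbabilityMeasure_dataLaw (σ := σ) hrate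
  have hm : MeasurableSet {q : (Fin N → ℕ → ℝ × ℝ) × ℝ |
      q.2 ∈ Ico 0 t ∧ ¬ ReceivedWithin i (u + q.2) (u + q.2 + w) q.1} :=
    (measurable_snd measurableSet_Ico).inter
      (measurableSet_receivedWithin_prod i (f := fun v => u + v) (g := fun v => u + v + w)
        (by fun_prop) (by fun_prop)).compl
  have h1 : ∫⁻ d, volume {v : ℝ | v ∈ Ico 0 t ∧ ¬ ReceivedWithin i (u + v) (u + v + w) d}
      ∂dataLaw rate σ = ENNReal.ofReal t * dataLaw rate σ {d | ¬ ReceivedWithin i 0 w d} := by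
    have h2 := (Measure.prod_apply (μ := dataLaw rate σ) (ν := volume) hm).symm.trans
      (Measure.prod_apply_symm hm)
    refine h2.trans ?_
    have h3 : ∀ v, dataLaw rate σ ((fun d => (d, v)) ⁻¹' {q : (Fin N → ℕ → ℝ × ℝ) × ℝ |
        q.2 ∈ Ico 0 t ∧ ¬ ReceivedWithin i (u + q.2) (u + q.2 + w) q.1}) =
        (Ico 0 t).indicator (fun _ => dataLaw rate σ {d | ¬ ReceivedWithin i 0 w d}) v := by
      intro v
      by_cases hv : v ∈ Ico 0 t
      · rw [indicator_of_mem hv, ← dataLaw_not_receivedWithin hrate hσ i (add_nonneg hu hv.1)]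
        congr 1
        ext d
        exact and_iff_right hv
      · rw [indicator_of_notMem hv]
        exact measure_mono_null (fun d hd => hv hd.1) measure_empty
    simp_rw [h3]
    rw [lintegral_indicator measurableSet_Ico, setLIntegral_const, Real.volume_Ico, sub_zero,
      mul_comm]
  have h4 : ∫ d, idleTime i w u t d ∂dataLaw rate σ =
      (∫⁻ d, volume {v : ℝ | v ∈ Ico 0 t ∧ ¬ ReceivedWithin i (u + v) (u + v + w) d}
        ∂dataLaw rate σ).toReal :=
    integral_toReal (measurable_measure_prodMk_left hm).aemeasurable
      (ae_of_all _ fun d => (volume_idle_ne_top i w u t d).lt_top)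
  rw [h4, h1, ENNReal.toReal_mul, ENNReal.toReal_ofReal ht]
  rfl

theorem dependsBefore_idleTime (i : Fin N) {w u t b : ℝ} (hb : u + t + w ≤ b) (s : Set ℝ) :
    DependsBefore b (idleTime i w u t ⁻¹' s) := by
  intro d d' _ _ h
  have : idleTime i w u t d = idleTime i w u t d' := by
    unfold idleTime
    congr 1
    ext v
    exact and_congr_right fun hv => not_congr (h.receivedWithin (by linarith [hv.2]))
  rw [mem_preimage, mem_preimage, this]

/-- A block of length w looks w further ahead, so block m is settled by time 2w(m + 1) + c, when
block m + 1 begins. The blocks are thus pairwise independent and identically distributed. -/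
theorem ae_tendsto_average_idleTime (hrate : ∀ j, 0 < rate j) (hσ : σ (Iio 0) = 0) (i : Fin N)
    {w c : ℝ} (hw : 0 < w) (hc : 0 ≤ c) :
    ∀ᵐ d ∂dataLaw rate σ, Tendsto
      (fun n : ℕ => (∑ m ∈ Finset.range n, idleTime i w (2 * w * m + c) w d) / n) atTop
      (𝓝 (w * (dataLaw rate σ).real {d | ¬ ReceivedWithin i 0 w d})) := by
  have := isProbabilityMeasure_dataLaw (σ := σ) hrate
  have hmeas : ∀ m : ℕ, Measurable (idleTime i w (2 * w * m + c) w) :=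
    fun m => measurable_idleTime i w _ w
  have hsame : ∀ (m : ℕ) {s : Set ℝ}, MeasurableSet s →
      dataLaw rate σ (idleTime i w (2 * w * m + c) w ⁻¹' s) =
        dataLaw rate σ (idleTime i w c w ⁻¹' s) := by
    intro m s hs
    have := dataLaw_shift (σ := σ) hrate hσ i (shiftCovariant_idleTime i w w hc hs)
      (u := 2 * w * m) (by positivity)
    simpa only [zero_add] using this
  have hlt : ∀ m m' : ℕ, m < m' → IndepFun (idleTime i w (2 * w * m + c) w)
      (idleTime i w (2 * w * m' + c) w) (dataLaw rate σ) := by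
    intro m m' hmm
    rw [indepFun_iff_measure_inter_preimage_eq_mul]
    intro s t hs ht
    have hm' : (m : ℝ) + 1 ≤ m' := by exact_mod_cast hmm
    -- The distance from the cut 2w(m + 1) + c to the start of block m'; it must be nonnegative for
    -- the later block to lie in the future of the cut.
    have hoff : 0 ≤ 2 * w * (m' - m - 1 : ℝ) := mul_nonneg (by positivity) (by linarith)
    have h := dataLaw_inter_shift (σ := σ) hrate hσ i
      (shiftCovariant_idleTime i w w hoff ht)
      (u := 2 * w * (m + 1) + c) (by positivity) (hmeas m hs)
      (dependsBefore_idleTime i (by linarith) s)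
    have e : 2 * w * (m + 1) + c + 2 * w * (m' - m - 1 : ℝ) = 2 * w * m' + c := by ring
    rw [e] at h
    rw [h, hsame m' ht]
    -- Starting at the offset and starting at c give the same law, both being compared with a start
    -- at their sum.
    have h' := dataLaw_shift (σ := σ) hrate hσ i (shiftCovariant_idleTime i w w hoff ht) hc
    have h'' := dataLaw_shift (σ := σ) hrate hσ i (shiftCovariant_idleTime i w w hc ht) hoff
    simp only [zero_add] at h' h''
    rw [zero_add, ← h'', ← h', add_comm c]
  have hslln := strong_law_ae_real (μ := dataLaw rate σ)
    (fun (m : ℕ) => idleTime i w (2 * w * m + c) w)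
    (Integrable.of_bound (hmeas 0).aestronglyMeasurable w (ae_of_all _ fun d => by
      rw [Real.norm_of_nonneg (idleTime_nonneg i w _ w d)]
      exact idleTime_le i w _ hw.le d))
    (by
      intro m m' hne
      rcases lt_or_gt_of_ne hne with h | h
      · exact hlt m m' h
      · exact (hlt m' m h).symm)
    (fun m => ⟨(hmeas m).aemeasurable, (hmeas 0).aemeasurable, by
      refine Measure.ext fun s hs => ?_
      rw [Measure.map_apply (hmeas m) hs, Measure.map_apply (hmeas 0) hs, hsame m hs, hsame 0 hs]⟩)
  rw [integral_idleTime hrate hσ i (by simpa using hc) hw.le] at hslln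
  exact hslln

/-- A monotone function which has a growth rate along an arithmetic progression. -/
theorem tendsto_div_of_monotone {g : ℝ → ℝ} (hg : Monotone g) {h c : ℝ} (hh : 0 < h)
    (hlim : Tendsto (fun n : ℕ => g (h * n) / n) atTop (𝓝 (h * c))) :
    Tendsto (fun t => g t / t) atTop (𝓝 c) := by
  have hfloor : Tendsto (fun t : ℝ => (⌊h⁻¹ * t⌋₊ : ℝ) / t) atTop (𝓝 h⁻¹) :=
    tendsto_nat_floor_mul_div_atTop (inv_nonneg.2 hh.le)
  have hM : Tendsto (fun t : ℝ => ⌊h⁻¹ * t⌋₊) atTop atTop :=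
    tendsto_nat_floor_atTop.comp (tendsto_id.const_mul_atTop (inv_pos.2 hh))
  have hc : h * c * h⁻¹ = c := by field_simp
  have hlow : Tendsto (fun t : ℝ => g (h * ⌊h⁻¹ * t⌋₊) / ⌊h⁻¹ * t⌋₊ * ((⌊h⁻¹ * t⌋₊ : ℝ) / t))
      atTop (𝓝 c) := by
    have := (hlim.comp hM).mul hfloor
    rwa [hc] at this
  have hfloor1 : Tendsto (fun t : ℝ => ((⌊h⁻¹ * t⌋₊ + 1 : ℕ) : ℝ) / t) atTop (𝓝 h⁻¹) := by
    have := hfloor.add (tendsto_inv_atTop_zero (𝕜 := ℝ))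
    rw [add_zero] at this
    refine this.congr fun t => ?_
    push_cast
    rw [add_div, one_div]
  have hupp : Tendsto (fun t : ℝ => g (h * (⌊h⁻¹ * t⌋₊ + 1 : ℕ)) / (⌊h⁻¹ * t⌋₊ + 1 : ℕ) *
      (((⌊h⁻¹ * t⌋₊ + 1 : ℕ) : ℝ) / t)) atTop (𝓝 c) := by
    have := (hlim.comp ((tendsto_add_atTop_nat 1).comp hM)).mul hfloor1
    rwa [hc] at this
  refine tendsto_of_tendsto_of_tendsto_of_le_of_le' hlow hupp ?_ ?_
  · filter_upwards [eventually_gt_atTop 0, hM.eventually_gt_atTop 0] with t ht hM0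
    have : (0 : ℝ) < ⌊h⁻¹ * t⌋₊ := by exact_mod_cast hM0
    rw [div_mul_div_cancel₀ this.ne']
    gcongr
    refine hg ?_
    have := Nat.floor_le (show 0 ≤ h⁻¹ * t by positivity)
    calc h * ⌊h⁻¹ * t⌋₊ ≤ h * (h⁻¹ * t) := by gcongr
      _ = t := by field_simp
  · filter_upwards [eventually_gt_atTop 0] with t ht
    have : (0 : ℝ) < (⌊h⁻¹ * t⌋₊ + 1 : ℕ) := by positivity
    rw [div_mul_div_cancel₀ this.ne']
    gcongr
    refine hg ?_
    have := (Nat.lt_floor_add_one (h⁻¹ * t)).le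
    calc t = h * (h⁻¹ * t) := by field_simp
      _ ≤ h * (⌊h⁻¹ * t⌋₊ + 1 : ℕ) := by push_cast; gcongr

theorem ae_tendsto_idleTime_div (hrate : ∀ j, 0 < rate j) (hσ : σ (Iio 0) = 0) (i : Fin N)
    {w : ℝ} (hw : 0 < w) :
    ∀ᵐ d ∂dataLaw rate σ, Tendsto (fun t => idleTime i w 0 t d / t) atTop
      (𝓝 ((dataLaw rate σ).real {d | ¬ ReceivedWithin i 0 w d})) := by
  filter_upwards [ae_tendsto_average_idleTime hrate hσ i hw le_rfl,
    ae_tendsto_average_idleTime hrate hσ i hw hw.le] with d h1 h2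
  -- The blocks with c = 0 and with c = w tile the half-line, so their sums add up to the idle time
  -- at multiples of 2w.
  refine tendsto_div_of_monotone (idleTime_mono i w 0 d) (h := 2 * w) (by positivity) ?_
  have h := h1.add h2
  rw [← add_mul, ← two_mul] at h
  refine h.congr fun n => ?_
  rw [← add_div]
  congr 1
  induction n with
  | zero => simp [idleTime]
  | succ n ih =>
    rw [Finset.sum_range_succ, Finset.sum_range_succ, add_add_add_comm, ih,
      show 2 * w * ((n + 1 : ℕ) : ℝ) = 2 * w * n + (w + w) by push_cast; ring,
      idleTime_add i w 0 (by positivity) (by positivity), idleTime_add i w _ hw.le hw.le]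
    simp only [zero_add, add_zero]

end

/-! ### The law of the inter-departure times. -/

section

variable {N : ℕ} {rate : Fin N → ℝ} {σ : Measure ℝ} [IsProbabilityMeasure σ]

@[fun_prop]
theorem measurable_interDeparture (i : Fin N) (k : ℕ) :
    Measurable (interDeparture (gap (N := N)) service i k) :=
  (measurable_departure i (k + 1)).sub (measurable_departure i k)

/-- Delays and failed insertions translate both departures, leaving their difference unchanged; a
received insertion lowers the index by one. The z = 0 first-step identity then equates the two laws.
-/
theorem map_interDeparture_succ (hrate : ∀ j, 0 < rate j) (hσ : σ (Iio 0) = 0) (i : Fin N)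
    (k : ℕ) : (dataLaw rate σ).map (interDeparture gap service i (k + 1)) =
      (dataLaw rate σ).map (interDeparture gap service i k) := by
  have := isProbabilityMeasure_dataLaw (σ := σ) hrate
  have hm := measurable_interDeparture i (N := N)
  refine Measure.ext fun s hs => ?_
  rw [Measure.map_apply (hm _) hs, Measure.map_apply (hm _) hs]
  have hind : ∀ {x y : ℝ}, x = y → s.indicator (fun _ => (1 : ℂ)) x = s.indicator (fun _ => 1) y :=
    fun h => by rw [h]
  have hreg := ae_dataLaw_pos hrate hσ
  have hrec := ae_receivedForever hrate hσ i
  have h := integral_eq_of_firstStep_const hrate hσ i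
    (F := fun d => s.indicator (fun _ => (1 : ℂ)) (interDeparture gap service i (k + 1) d))
    (F' := fun d => s.indicator (fun _ => (1 : ℂ)) (interDeparture gap service i k d))
    ((measurable_const.indicator hs).comp (hm _))
    (fun d => by by_cases hd : interDeparture gap service i (k + 1) d ∈ s <;> simp [hd])
    (by
      filter_upwards [hreg, hrec] with d hd hf p _ _ j hj
      refine hind ?_
      rw [interDeparture, departure_insertFirst hd hf.infinite hj,
        departure_insertFirst hd hf.infinite hj, interDeparture]
      ring)
    (ae_of_all _ fun d s _ => hind (by
      rw [interDeparture, departure_delay, departure_delay, interDeparture]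
      ring))
    (by
      filter_upwards [hreg, hrec] with d hd hf p _ hp2
      refine hind ?_
      have hd' := Regular.delay hd hp2
      have hle : ∀ k, p.2 ≤ (delay (fun _ => p.2) d k 0).1 := fun k => by
        rw [gap_delay_zero]
        have := (hd k 0).1
        linarith
      have hinf : (Set.ofPred (Received gap service i (delay (fun _ => p.2) d))).Infinite := by
        have : Received gap service i (delay (fun _ => p.2) d) = Received gap service i d :=
          funext fun _ => propext received_delay
        rw [this]; exact hf.infinite
      cases k with
      -- The fresh copy starts exactly when the inserted update departs, which matches the
      -- convention that departure 0 is time 0.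
      | zero =>
        rw [interDeparture, departure_add_two_insertFirst hd' hinf hle,
          departure_one_insertFirst hd' hle, departure_delay, interDeparture]
        simp [departure]
      | succ k =>
        rw [interDeparture, departure_add_two_insertFirst hd' hinf hle,
          departure_add_two_insertFirst hd' hinf hle, departure_delay, departure_delay,
          interDeparture]
        ring)
  have hint : ∀ k, ∫ d, s.indicator (fun _ => (1 : ℂ)) (interDeparture gap service i k d)
      ∂dataLaw rate σ = (dataLaw rate σ).real (interDeparture gap service i k ⁻¹' s) := by
    intro k
    have : (fun d => s.indicator (fun _ => (1 : ℂ)) (interDeparture gap service i k d)) =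
        (interDeparture gap service i k ⁻¹' s).indicator fun _ => 1 := rfl
    rw [this, integral_indicator (hm k hs)]
    simp
  rw [hint, hint] at h
  exact (ENNReal.toReal_eq_toReal_iff' (measure_ne_top _ _) (measure_ne_top _ _)).1
    (Complex.ofReal_injective h)

/-- The law of the inter-departure times. -/
noncomputable def interDepartureLaw (rate : Fin N → ℝ) (σ : Measure ℝ) (i : Fin N) : Measure ℝ :=
  (dataLaw rate σ).map fun d => departure gap service i d 1

theorem map_interDeparture (hrate : ∀ j, 0 < rate j) (hσ : σ (Iio 0) = 0) (i : Fin N) (k : ℕ) :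
    (dataLaw rate σ).map (interDeparture gap service i k) = interDepartureLaw rate σ i := by
  induction k with
  | zero =>
    have : interDeparture (gap (N := N)) service i 0 = fun d => departure gap service i d 1 := by
      funext d; simp [interDeparture, departure]
    rw [this, interDepartureLaw]
  | succ k ih => rw [map_interDeparture_succ hrate hσ, ih]

theorem isProbabilityMeasure_interDepartureLaw (hrate : ∀ j, 0 < rate j) (i : Fin N) :
    IsProbabilityMeasure (interDepartureLaw rate σ i) := by
  have := isProbabilityMeasure_dataLaw (σ := σ) hrate
  exact Measure.isProbabilityMeasure_map (measurable_departure i 1).aemeasurable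

theorem Regular.departure_one_pos {d : Fin N → ℕ → ℝ × ℝ} (hd : Regular d) (i : Fin N) :
    0 < departure gap service i d 1 :=
  add_pos_of_pos_of_nonneg (hd.arrival_pos i _) (hd i _).2

theorem ae_interDepartureLaw_pos (hrate : ∀ j, 0 < rate j) (hσ : σ (Iio 0) = 0) (i : Fin N) :
    ∀ᵐ x ∂interDepartureLaw rate σ i, 0 < x := by
  rw [interDepartureLaw, ae_map_iff (measurable_departure i 1).aemeasurable measurableSet_Ioi]
  filter_upwards [ae_dataLaw_pos hrate hσ] with d hd
  exact Regular.departure_one_pos hd i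

theorem integral_cexp_interDepartureLaw (hrate : ∀ j, 0 < rate j) (hσ : σ (Iio 0) = 0)
    (i : Fin N) {z : ℂ} (hz : 0 < z.re) :
    ∫ x, Complex.exp (-z * (x : ℂ)) ∂interDepartureLaw rate σ i =
      rate i * laplace σ ((∑ j, rate j : ℝ) + z) /
        (rate i * laplace σ ((∑ j, rate j : ℝ) + z) + z) := by
  have := isProbabilityMeasure_dataLaw (σ := σ) hrate
  have hreg := ae_dataLaw_pos hrate hσ
  have hrec := ae_receivedForever hrate hσ i
  have hdep := measurable_departure i 1
  -- Truncating at 0 gives the bound by 1 for every path; nothing changes on regular ones.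
  set F : (Fin N → ℕ → ℝ × ℝ) → ℂ :=
    fun d => Complex.exp (-z * (max (departure gap service i d 1) 0 : ℝ)) with hF
  have hFd : ∀ d, Regular d → F d = Complex.exp (-z * (departure gap service i d 1 : ℝ)) := by
    intro d hd
    simp only [hF]
    rw [max_eq_left (hd.departure_one_pos i).le]
  have h := integral_eq_of_firstStep hrate hσ i hz.le (F := F) (F' := fun _ => 1)
    (by fun_prop)
    (fun d => by
      rw [Complex.norm_exp]
      simpa using mul_nonneg hz.le (le_max_right (departure gap service i d 1) 0))
    (by
      filter_upwards [hreg, hrec] with d hd hf p hp1 hp2 j hj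
      rw [hFd _ (Regular.insertFirst hd hp1 hp2 j), hFd d hd,
        departure_insertFirst hd hf.infinite hj, ← Complex.exp_add]
      congr 1
      push_cast
      ring)
    (by
      filter_upwards [hreg] with d hd s hs
      rw [hFd _ (Regular.delay hd hs), hFd d hd, departure_delay, ← Complex.exp_add]
      congr 1
      push_cast
      ring)
    (by
      filter_upwards [hreg] with d hd p hp1 hp2
      have hd' := Regular.delay hd hp2
      rw [hFd _ (hd'.insertFirst hp1 hp2 i), departure_one_insertFirst hd' fun k => by
        rw [gap_delay_zero]
        have := (hd k 0).1
        linarith, mul_one])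
  have e1 : ∫ x, Complex.exp (-z * (x : ℂ)) ∂interDepartureLaw rate σ i =
      ∫ d, F d ∂dataLaw rate σ := by
    rw [interDepartureLaw, integral_map hdep.aemeasurable (by fun_prop)]
    refine integral_congr_ae ?_
    filter_upwards [hreg] with d hd using (hFd d hd).symm
  rw [e1]
  simp only [integral_const, probReal_univ, one_smul] at h
  -- If the denominator vanished, the first-step identity would read z φ = -z (1 - φ), forcing z =
  -- 0.
  have hne : (rate i : ℂ) * laplace σ ((∑ j, rate j : ℝ) + z) + z ≠ 0 := by
    intro h0
    have hz0 : z = 0 := by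
      linear_combination (1 - ∫ d, F d ∂dataLaw rate σ) * h0 + h
    rw [hz0] at hz
    simp at hz
  rw [eq_div_iff hne]
  linear_combination h

/-- The first departure is the exponential time of the first point plus either its mark or the first
departure of the remaining path, both independent of that time. Translates of a null set are null
for the exponential law, so either sum avoids the set almost surely. -/
theorem interDepartureLaw_absolutelyContinuous (hrate : ∀ j, 0 < rate j) (hσ : σ (Iio 0) = 0)
    (i : Fin N) : interDepartureLaw rate σ i ≪ volume := by
  have hpos : 0 < ∑ k, rate k := Finset.sum_pos (fun k _ => hrate k) ⟨i, Finset.mem_univ i⟩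
  have : IsProbabilityMeasure (expMeasure (∑ k, rate k)) := isProbabilityMeasure_expMeasure hpos
  have := isProbabilityMeasure_dataLaw (σ := σ) hrate
  refine Measure.AbsolutelyContinuous.mk fun s hs hs0 => ?_
  have hexp : ∀ c : ℝ, ∀ᵐ x ∂expMeasure (∑ k, rate k), x + c ∉ s := fun c => by
    refine expMeasure_absolutelyContinuous _ |>.ae_le ?_
    exact (measure_eq_zero_iff_ae_notMem).1 ((measure_preimage_add_right volume c s).trans hs0)
  have h1 : ∀ᵐ p ∂(expMeasure (∑ k, rate k)).prod σ, p.1 + p.2 ∉ s := by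
    have hm : MeasurableSet {p : ℝ × ℝ | p.1 + p.2 ∉ s} := (measurable_fst.add measurable_snd) hs.compl
    exact (Measure.ae_prod_iff_ae_ae hm).2 ((Measure.ae_ae_comm hm).2 (ae_of_all _ hexp))
  have h2 : ∀ᵐ p ∂(expMeasure (∑ k, rate k)).prod σ, ∀ᵐ d ∂dataLaw rate σ,
      p.1 + departure gap service i d 1 ∉ s := by
    have hm : MeasurableSet {q : ℝ × (Fin N → ℕ → ℝ × ℝ) |
        q.1 + departure gap service i q.2 1 ∉ s} :=
      (measurable_fst.add ((measurable_departure i 1).comp measurable_snd)) hs.compl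
    exact Measure.quasiMeasurePreserving_fst.ae
      (p := fun x => ∀ᵐ d ∂dataLaw rate σ, x + departure gap service i d 1 ∉ s)
      ((Measure.ae_ae_comm hm).2 (ae_of_all _ fun d => hexp _))
  have hms : MeasurableSet ((fun d : Fin N → ℕ → ℝ × ℝ => departure gap service i d 1) ⁻¹' s) :=
    measurable_departure i 1 hs
  rw [interDepartureLaw, Measure.map_apply (measurable_departure i 1) hs,
    dataLaw_eq_sum hrate hσ i, Measure.finsetSum_apply]
  refine Finset.sum_eq_zero fun j _ => ?_
  rw [Measure.smul_apply, Measure.map_apply (by fun_prop) hms,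
    Measure.measure_prod_null_of_ae_null (measurable_insertFirst j hms), smul_zero]
  filter_upwards [h1, h2] with p hp1 hp2
  refine (measure_eq_zero_iff_ae_notMem).2 ?_
  filter_upwards [hp2, ae_dataLaw_pos hrate hσ, ae_receivedForever hrate hσ i] with d hp2 hd hf
  by_cases hj : j ≠ i ∨ ∃ k, (d k 0).1 < p.2
  · change departure gap service i (insertFirst j p d) 1 ∉ s
    rwa [departure_insertFirst hd hf.infinite hj]
  · push Not at hj
    obtain ⟨rfl, hj⟩ := hj
    change departure gap service j (insertFirst j p d) 1 ∉ s
    rwa [departure_one_insertFirst hd hj]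

theorem real_dataLaw_not_receivedWithin (hrate : ∀ j, 0 < rate j) (hσ : σ (Iio 0) = 0)
    (i : Fin N) (w : ℝ) : (dataLaw rate σ).real {d | ¬ ReceivedWithin i 0 w d} =
      (interDepartureLaw rate σ i).real (Ioi w) := by
  rw [interDepartureLaw, map_measureReal_apply (measurable_departure i 1) measurableSet_Ioi]
  refine measureReal_congr ?_
  filter_upwards [ae_dataLaw_pos hrate hσ, ae_receivedForever hrate hσ i] with d hd hf
  exact propext ((not_congr (Regular.departure_one_le_iff hd hf).symm).trans not_le)

end

/-! ### Uniqueness of the inverse transform, and densities. -/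

section

/-- Injectivity of the Fourier transform of integrable real functions. -/
theorem ae_eq_zero_of_integral_cexp_eq_zero {μ : Measure ℝ} {h : ℝ → ℝ} (hh : Integrable h μ)
    (h0 : ∀ t : ℝ, ∫ x, Complex.exp (t * x * Complex.I) * (h x : ℂ) ∂μ = 0) : h =ᵐ[μ] 0 := by
  have hfin1 : IsFiniteMeasure (μ.withDensity fun x => ENNReal.ofReal (h x)) :=
    isFiniteMeasure_withDensity_ofReal hh.2
  have hfin2 : IsFiniteMeasure (μ.withDensity fun x => ENNReal.ofReal (-h x)) :=
    isFiniteMeasure_withDensity_ofReal hh.neg.2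
  have hm1 : AEMeasurable (fun x => ENNReal.ofReal (h x)) μ := hh.aemeasurable.ennreal_ofReal
  have hm2 : AEMeasurable (fun x => ENNReal.ofReal (-h x)) μ := hh.neg.aemeasurable.ennreal_ofReal
  have hbdd : ∀ (t : ℝ) {g : ℝ → ℝ}, Integrable g μ →
      Integrable (fun x : ℝ => (g x : ℂ) * Complex.exp (t * x * Complex.I)) μ := by
    intro t g hg
    refine hg.ofReal.mul_bdd (c := 1) (by fun_prop) (ae_of_all _ fun x => ?_)
    rw [Complex.norm_exp]
    simp
  -- The positive and negative parts of h are densities of two finite measures; vanishing of the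
  -- transform equates their characteristic functions.
  have hchar : charFun (μ.withDensity fun x => ENNReal.ofReal (h x)) =
      charFun (μ.withDensity fun x => ENNReal.ofReal (-h x)) := by
    funext t
    rw [charFun_apply_real, charFun_apply_real,
      integral_withDensity_eq_integral_toReal_smul₀ hm1 (by simp),
      integral_withDensity_eq_integral_toReal_smul₀ hm2 (by simp), ← sub_eq_zero]
    simp only [ENNReal.toReal_ofReal', Complex.real_smul]
    rw [← integral_sub (hbdd t hh.pos_part) (hbdd t (g := fun x => max (-h x) 0) hh.neg.pos_part),
      ← h0 t]
    refine integral_congr_ae (ae_of_all _ fun x => ?_)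
    have : (max (h x) 0 : ℝ) - max (-h x) 0 = h x := by
      rcases le_total (h x) 0 with hx | hx
      · rw [max_eq_right hx, max_eq_left (by linarith)]; ring
      · rw [max_eq_left hx, max_eq_right (by linarith)]; ring
    beta_reduce
    rw [← sub_mul, ← Complex.ofReal_sub, this, mul_comm]
  have heq := Measure.ext_of_charFun hchar
  have hae := (withDensity_eq_iff hm1 hm2 (by
    have := hfin1.measure_univ_lt_top
    rw [withDensity_apply _ MeasurableSet.univ, Measure.restrict_univ] at this
    exact this.ne)).1 heq
  filter_upwards [hae] with x hx
  have := congrArg ENNReal.toReal hx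
  simp only [ENNReal.toReal_ofReal'] at this
  change h x = 0
  rcases le_total (h x) 0 with hx | hx
  · rw [max_eq_right hx, max_eq_left (by linarith)] at this; linarith
  · rw [max_eq_left hx, max_eq_right (by linarith)] at this; linarith

/-- The line re s = 1 suffices: there the transform is the Fourier transform of the integrable
function exp (-x) f x on the positive half-line. -/
theorem IsInverseLaplace.ae_eq {F : ℂ → ℂ} {f g : ℝ → ℝ} (hf : IsInverseLaplace F f)
    (hg : IsInverseLaplace F g) : f =ᵐ[volume] g := by
  have hreal : ∀ {f : ℝ → ℝ}, IsInverseLaplace F f →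
      Integrable (fun x => Real.exp (-x) * f x) (volume.restrict (Ioi 0)) := by
    intro f hf
    refine (hf.2 1 (by simp)).1.re.congr (ae_of_all _ fun x => ?_)
    have : Complex.exp (-1 * (x : ℂ)) * (f x : ℂ) = ((Real.exp (-x) * f x : ℝ) : ℂ) := by
      push_cast; ring_nf
    change (Complex.exp (-1 * (x : ℂ)) * (f x : ℂ)).re = _
    rw [this, Complex.ofReal_re]
  have hdiff := (hreal hf).sub (hreal hg)
  have hzero := ae_eq_zero_of_integral_cexp_eq_zero hdiff fun t => by
    obtain ⟨if1, if2⟩ := hf.2 (1 - t * Complex.I) (by simp)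
    obtain ⟨ig1, ig2⟩ := hg.2 (1 - t * Complex.I) (by simp)
    rw [← sub_eq_zero.2 (if2.trans ig2.symm), ← integral_sub if1 ig1]
    refine integral_congr_ae (ae_of_all _ fun x => ?_)
    change _ * ((Real.exp (-x) * f x - Real.exp (-x) * g x : ℝ) : ℂ) =
      Complex.exp (-(1 - t * Complex.I) * x) * f x - Complex.exp (-(1 - t * Complex.I) * x) * g x
    push_cast
    rw [← mul_sub, ← mul_sub, ← mul_assoc, ← Complex.exp_add]
    congr 2
    ring
  rw [EventuallyEq, ae_restrict_iff' measurableSet_Ioi] at hzero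
  have hne : ∀ᵐ x : ℝ, x ≠ 0 := by simp [ae_iff]
  filter_upwards [hzero, hne] with x hx hx0
  rcases lt_or_gt_of_ne hx0 with h | h
  · rw [hf.1 x h, hg.1 x h]
  · have h1 : Real.exp (-x) * f x - Real.exp (-x) * g x = 0 := hx h
    rw [← mul_sub, mul_eq_zero] at h1
    linarith [h1.resolve_left (Real.exp_pos _).ne']

section Density

variable {ν : Measure ℝ} [IsProbabilityMeasure ν]

/-- A density of a law on the nonnegative half-line, vanishing on the negative one. -/
noncomputable def halfLineDensity (ν : Measure ℝ) : ℝ → ℝ :=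
  (Ici 0).indicator fun x => (ν.rnDeriv volume x).toReal

theorem measurable_halfLineDensity (ν : Measure ℝ) : Measurable (halfLineDensity ν) :=
  (Measure.measurable_rnDeriv ν volume).ennreal_toReal.indicator measurableSet_Ici

theorem halfLineDensity_nonneg (ν : Measure ℝ) (x : ℝ) : 0 ≤ halfLineDensity ν x :=
  indicator_nonneg (fun _ _ => ENNReal.toReal_nonneg) x

theorem withDensity_halfLineDensity (hν : ν ≪ volume) (hpos : ∀ᵐ x ∂ν, 0 < x) :
    volume.withDensity (fun x => ENNReal.ofReal (halfLineDensity ν x)) = ν := by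
  have h1 : (fun x => ENNReal.ofReal (halfLineDensity ν x)) =ᵐ[volume]
      (Ici 0).indicator (ν.rnDeriv volume) := by
    filter_upwards [Measure.rnDeriv_lt_top ν volume] with x hx
    by_cases hx0 : x ∈ Ici (0 : ℝ)
    · rw [halfLineDensity, indicator_of_mem hx0, indicator_of_mem hx0, ENNReal.ofReal_toReal hx.ne]
    · rw [halfLineDensity, indicator_of_notMem hx0, indicator_of_notMem hx0, ENNReal.ofReal_zero]
  rw [withDensity_congr_ae h1, withDensity_indicator measurableSet_Ici,
    ← restrict_withDensity measurableSet_Ici, Measure.withDensity_rnDeriv_eq _ _ hν]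
  exact Measure.restrict_eq_self_of_ae_mem (hpos.mono fun x hx => hx.le)

theorem isInverseLaplace_halfLineDensity (hν : ν ≪ volume) (hpos : ∀ᵐ x ∂ν, 0 < x) {F : ℂ → ℂ}
    (hF : ∀ s : ℂ, 0 < s.re → ∫ x, Complex.exp (-s * (x : ℂ)) ∂ν = F s) :
    IsInverseLaplace F (halfLineDensity ν) := by
  refine ⟨fun x hx => indicator_of_notMem (not_le.2 hx) _, fun s hs => ?_⟩
  have hm : Measurable fun x => ENNReal.ofReal (halfLineDensity ν x) :=
    (measurable_halfLineDensity ν).ennreal_ofReal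
  have hexp : Integrable (fun x : ℝ => Complex.exp (-s * (x : ℂ))) ν := by
    refine Integrable.of_bound (by fun_prop) 1 ?_
    filter_upwards [hpos] with x hx
    rw [Complex.norm_exp]
    simpa using mul_nonneg hs.le hx.le
  have hcomm : ∀ x : ℝ, (ENNReal.ofReal (halfLineDensity ν x)).toReal •
      Complex.exp (-s * (x : ℂ)) = Complex.exp (-s * (x : ℂ)) * (halfLineDensity ν x : ℂ) := by
    intro x
    rw [ENNReal.toReal_ofReal (halfLineDensity_nonneg ν x), Complex.real_smul, mul_comm]
  rw [← withDensity_halfLineDensity hν hpos,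
    integrable_withDensity_iff_integrable_smul' hm (by simp)] at hexp
  simp_rw [hcomm] at hexp
  refine ⟨hexp.integrableOn, ?_⟩
  rw [← hF s hs]
  conv_rhs => rw [← withDensity_halfLineDensity hν hpos,
    integral_withDensity_eq_integral_toReal_smul hm (by simp)]
  simp_rw [hcomm]
  refine setIntegral_eq_integral_of_ae_compl_eq_zero ?_
  have hne : ∀ᵐ x : ℝ, x ≠ 0 := by simp [ae_iff]
  filter_upwards [hne] with x hx0 hx
  have hx' : x < 0 := lt_of_le_of_ne (not_lt.1 hx) hx0
  rw [halfLineDensity, indicator_of_notMem (s := Ici 0) (not_le.2 hx'), Complex.ofReal_zero, mul_zero]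

theorem one_sub_integral_halfLineDensity (hν : ν ≪ volume) (hpos : ∀ᵐ x ∂ν, 0 < x) {w : ℝ}
    (hw : 0 ≤ w) : 1 - ∫ x in (0 : ℝ)..w, halfLineDensity ν x = ν.real (Ioi w) := by
  have h1 : ∫ x in (0 : ℝ)..w, halfLineDensity ν x = ν.real (Ioc 0 w) := by
    rw [intervalIntegral.integral_of_le hw, integral_eq_lintegral_of_nonneg_ae
      (ae_of_all _ (halfLineDensity_nonneg ν)) (measurable_halfLineDensity ν).aestronglyMeasurable,
      ← withDensity_apply _ measurableSet_Ioc, withDensity_halfLineDensity hν hpos]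
    rfl
  have h2 : ν.real (Ioc 0 w) = ν.real (Iic w) := by
    refine measureReal_congr ?_
    filter_upwards [hpos] with x hx
    exact propext ⟨fun h => h.2, fun h => ⟨hx, h⟩⟩
  rw [h1, h2, ← compl_Iic, probReal_compl_eq_one_sub measurableSet_Iic]

end Density

end

/-! ### From the canonical space back to the given system. -/

section

variable {N : ℕ} {i : Fin N}

/-- The age at u never exceeds u, so violations occur only after w; translating by w turns them into
idle instants, up to the endpoints of the interval. -/
theorem Regular.volume_lt_aoi {d : Fin N → ℕ → ℝ × ℝ} (hd : Regular d) (hf : ReceivedForever i d)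
    {w t : ℝ} (hw : 0 ≤ w) :
    volume.real {u : ℝ | u ∈ Icc 0 t ∧ w < aoi gap service i u d} =
      idleTime i w 0 (t - w) d := by
  have h1 : {u : ℝ | u ∈ Icc 0 t ∧ w < aoi gap service i u d} =
      {u : ℝ | u ∈ Ioc w t ∧ ¬ ReceivedWithin i (u - w) u d} := by
    ext u
    constructor
    · rintro ⟨hu, hlt⟩
      have hwu : w < u := hlt.trans_le (hd.aoi_le u)
      exact ⟨⟨hwu, hu.2⟩, (hd.lt_aoi_iff hf hw hwu).1 hlt⟩
    · rintro ⟨hu, hlt⟩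
      exact ⟨⟨hw.trans hu.1.le, hu.2⟩, (hd.lt_aoi_iff hf hw hu.1).2 hlt⟩
  rw [h1, idleTime, measureReal_def, measureReal_def, ← measure_preimage_add_right volume w]
  congr 1
  have h2 : (fun v => v + w) ⁻¹' {u : ℝ | u ∈ Ioc w t ∧ ¬ ReceivedWithin i (u - w) u d} =
      Ioc 0 (t - w) ∩ {v : ℝ | ¬ ReceivedWithin i (0 + v) (0 + v + w) d} := by
    ext v
    simp only [mem_preimage, mem_ofPred_eq, mem_Ioc, mem_inter_iff, lt_add_iff_pos_left,
      le_sub_iff_add_le, add_sub_cancel_right, zero_add]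
  have h3 : {v : ℝ | v ∈ Ico 0 (t - w) ∧ ¬ ReceivedWithin i (0 + v) (0 + v + w) d} =
      Ico 0 (t - w) ∩ {v : ℝ | ¬ ReceivedWithin i (0 + v) (0 + v + w) d} := rfl
  rw [h2, h3]
  exact measure_congr (Ico_ae_eq_Ioc.symm.inter ae_eq_rfl)

/-- A function which is eventually at most `1` and eventually above functions with limits arbitrarily
close to `1` tends to `1`. -/
theorem tendsto_one_of_le {g : ℝ → ℝ} {G : ℕ → ℝ → ℝ} {c : ℕ → ℝ}
    (hle : ∀ᶠ t in atTop, g t ≤ 1) (hG : ∀ n, Tendsto (G n) atTop (𝓝 (c n)))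
    (hGg : ∀ n, ∀ᶠ t in atTop, G n t ≤ g t) (hc : Tendsto c atTop (𝓝 1)) :
    Tendsto g atTop (𝓝 1) := by
  refine tendsto_order.2 ⟨fun a ha => ?_, fun a ha => ?_⟩
  · obtain ⟨n, hn⟩ := ((tendsto_order.1 hc).1 a ha).exists
    filter_upwards [(tendsto_order.1 (hG n)).1 a hn, hGg n] with t h1 h2 using h1.trans_le h2
  · filter_upwards [hle] with t ht using ht.trans_lt ha

/-- A violation probability of the form `ν (w, ∞)` for all `w > 0`, with a law `ν` on the positive
half-line, is of this form for all `w`. -/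
theorem isViolationProbability_of_forall_pos {Ω : Type*} [MeasurableSpace Ω] {P : Measure Ω}
    [IsProbabilityMeasure P] {Δ : ℝ → Ω → ℝ} {ν : Measure ℝ} [IsProbabilityMeasure ν]
    (hpos : ∀ᵐ x ∂ν, 0 < x)
    (h : ∀ w, 0 < w → IsViolationProbability P Δ w (ν.real (Ioi w))) (w : ℝ) :
    IsViolationProbability P Δ w (ν.real (Ioi w)) := by
  rcases lt_or_ge 0 w with hw | hw
  · exact h w hw
  have hone : ∀ w' ≤ 0, ν.real (Ioi w') = 1 := by
    intro w' hw'
    have : ν (Ioi w') = 1 := (prob_compl_eq_zero_iff measurableSet_Ioi).1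
      (measure_eq_zero_iff_ae_notMem.2 (hpos.mono fun x hx => not_not.2 (hw'.trans_lt hx)))
    simp [measureReal_def, this]
  have hε : ∀ n : ℕ, (0 : ℝ) < 1 / ((n : ℝ) + 1) := fun n => Nat.one_div_pos_of_nat
  -- For w ≤ 0 the value is 1, and it is squeezed between 1 and the positive thresholds 1 / (n + 1),
  -- whose values tend to 1 as ν charges only the positive half-line.
  have hc : Tendsto (fun n : ℕ => ν.real (Ioi (1 / ((n : ℝ) + 1)))) atTop (𝓝 1) := by
    have hmono : Monotone fun n : ℕ => Ioi (1 / ((n : ℝ) + 1)) := fun m n hmn =>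
      Ioi_subset_Ioi (Nat.one_div_le_one_div hmn)
    have hunion : ⋃ n : ℕ, Ioi (1 / ((n : ℝ) + 1)) = Ioi (0 : ℝ) := by
      ext x
      simp only [mem_iUnion, mem_Ioi]
      exact ⟨fun ⟨n, hn⟩ => (hε n).trans hn, fun hx => exists_nat_one_div_lt hx⟩
    have := (ENNReal.tendsto_toReal (measure_ne_top ν _)).comp
      (tendsto_measure_iUnion_atTop (μ := ν) hmono)
    rw [hunion] at this
    have h0 := hone 0 le_rfl
    rw [measureReal_def] at h0
    rw [h0] at this
    exact this
  rw [hone w hw]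
  constructor
  · have hall : ∀ᵐ ω ∂P, ∀ n : ℕ, Tendsto (fun t : ℝ =>
        volume.real {u : ℝ | u ∈ Icc 0 t ∧ 1 / ((n : ℝ) + 1) < Δ u ω} / t) atTop
        (𝓝 (ν.real (Ioi (1 / ((n : ℝ) + 1))))) := ae_all_iff.2 fun n => (h _ (hε n)).1
    filter_upwards [hall] with ω hω
    refine tendsto_one_of_le ?_ hω (fun n => ?_) hc
    · filter_upwards [eventually_gt_atTop 0] with t ht
      rw [div_le_one ht]
      refine (measureReal_mono (fun u hu => hu.1 : _ ⊆ Icc 0 t) (by simp)).trans ?_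
      simp [ht.le]
    · filter_upwards [eventually_gt_atTop 0] with t ht
      refine div_le_div_of_nonneg_right (measureReal_mono (fun u hu =>
        ⟨hu.1, (hw.trans_lt (hε n)).trans hu.2⟩) ?_) ht.le
      exact measure_ne_top_of_subset (fun u hu => hu.1 : _ ⊆ Icc 0 t) (by simp)
  · refine tendsto_one_of_le (Eventually.of_forall fun t => measureReal_le_one)
      (fun n => (h _ (hε n)).2) (fun n => Eventually.of_forall fun t => ?_) hc
    exact measureReal_mono (fun ω hω => (hw.trans_lt (hε n)).trans hω)

variable {Ω : Type*} [MeasurableSpace Ω] {P : Measure Ω}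
  {rate : Fin N → ℝ} {σ : Measure ℝ} {X S : Fin N → ℕ → Ω → ℝ}

theorem IsInput.measurable_data (h : IsInput P rate σ X S) :
    Measurable fun ω j n => (X j n ω, S j n ω) :=
  measurable_pi_lambda _ fun j => measurable_pi_lambda _ fun n =>
    (h.measurable_X j n).prodMk (h.measurable_S j n)

variable [IsProbabilityMeasure σ]

theorem IsInput.ae_of_dataLaw (hrate : ∀ j, 0 < rate j) (h : IsInput P rate σ X S)
    {Q : (Fin N → ℕ → ℝ × ℝ) → Prop} (hQ : ∀ᵐ d ∂dataLaw rate σ, Q d) :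
    ∀ᵐ ω ∂P, Q fun j n => (X j n ω, S j n ω) := by
  rw [← h.map_eq_dataLaw hrate] at hQ
  exact ae_of_ae_map h.measurable_data.aemeasurable hQ

theorem IsInput.isViolationProbability_aoi (hrate : ∀ j, 0 < rate j) (hσ : σ (Iio 0) = 0)
    (h : IsInput P rate σ X S) (i : Fin N) {w : ℝ} (hw : 0 < w) :
    IsViolationProbability P (aoi X S i) w ((interDepartureLaw rate σ i).real (Ioi w)) := by
  have hreg : ∀ᵐ ω ∂P, Regular fun j n => (X j n ω, S j n ω) :=
    h.ae_of_dataLaw hrate (ae_dataLaw_pos hrate hσ)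
  have hrec := h.ae_of_dataLaw hrate (ae_receivedForever hrate hσ i)
  rw [← real_dataLaw_not_receivedWithin hrate hσ i w]
  constructor
  · filter_upwards [hreg, hrec, h.ae_of_dataLaw hrate (ae_tendsto_idleTime_div hrate hσ i hw)]
      with ω h1 h2 h3
    have hfrac : ∀ t : ℝ, volume.real {u : ℝ | u ∈ Icc 0 t ∧ w < aoi X S i u ω} =
        idleTime i w 0 (t - w) fun j n => (X j n ω, S j n ω) :=
      fun t => Regular.volume_lt_aoi h1 h2 hw.le
    simp_rw [hfrac]
    have hratio : Tendsto (fun t : ℝ => (t - w) / t) atTop (𝓝 1) := by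
      have h4 := (tendsto_inv_atTop_zero (𝕜 := ℝ)).const_mul w
      have h5 := h4.const_sub 1
      rw [mul_zero, sub_zero] at h5
      refine h5.congr' ?_
      filter_upwards [eventually_ne_atTop 0] with t ht
      field_simp
    have h6 := (h3.comp (tendsto_atTop_add_const_right atTop (-w) tendsto_id)).mul hratio
    rw [mul_one] at h6
    refine h6.congr' ?_
    filter_upwards [eventually_gt_atTop w] with t ht
    have : t - w ≠ 0 := (sub_pos.2 ht).ne'
    exact div_mul_div_cancel₀ this
  -- By stationarity the probability is constant once t > w, so no limit has to be computed.
  · refine tendsto_const_nhds.congr' ?_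
    filter_upwards [eventually_gt_atTop w] with t ht
    have hm := (measurableSet_receivedWithin i (t - w) t).compl
    have h1 : P.real {ω | w < aoi X S i t ω} = P.real ((fun ω j n => (X j n ω, S j n ω)) ⁻¹'
        {d | ReceivedWithin i (t - w) t d}ᶜ) := by
      refine measureReal_congr ?_
      filter_upwards [hreg, hrec] with ω h1 h2
      exact propext (Regular.lt_aoi_iff h1 h2 hw.le ht)
    rw [h1, ← map_measureReal_apply h.measurable_data hm, h.map_eq_dataLaw hrate]
    have h2 := dataLaw_not_receivedWithin (σ := σ) hrate hσ i (w := w) (sub_pos.2 ht).le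
    rw [sub_add_cancel] at h2
    exact congrArg ENNReal.toReal h2.symm

end

end MG11

theorem theorem2 {Ω : Type*} [MeasurableSpace Ω] (P : Measure Ω) [IsProbabilityMeasure P]
    {N : ℕ} (rate : Fin N → ℝ) (hrate : ∀ j, 0 < rate j)
    (σ : Measure ℝ) [IsProbabilityMeasure σ] (hσ : σ (Iio 0) = 0)
    (X S : Fin N → ℕ → Ω → ℝ) (hXS : MG11.IsInput P rate σ X S) (i : Fin N) :
    ∃ f : ℝ → ℝ, Measurable f ∧ (∀ x, 0 ≤ f x) ∧
      -- `f` is the inverse Laplace transform of `λᵢ L_S(λ + s) / (λᵢ L_S(λ + s) + s)`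
      MG11.IsInverseLaplace (fun s : ℂ =>
        (rate i : ℂ) * MG11.laplace σ (((∑ j, rate j : ℝ) : ℂ) + s) /
          ((rate i : ℂ) * MG11.laplace σ (((∑ j, rate j : ℝ) : ℂ) + s) + s)) f ∧
      (∀ g : ℝ → ℝ, MG11.IsInverseLaplace (fun s : ℂ =>
        (rate i : ℂ) * MG11.laplace σ (((∑ j, rate j : ℝ) : ℂ) + s) /
          ((rate i : ℂ) * MG11.laplace σ (((∑ j, rate j : ℝ) : ℂ) + s) + s)) g →
        g =ᵐ[volume] f) ∧
      -- the violation probability of the AoI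
      (∀ w : ℝ, 0 < w →
        MG11.IsViolationProbability P (MG11.aoi X S i) w (1 - ∫ x in (0 : ℝ)..w, f x)) ∧
      -- `f` is the density of the stationary AoI
      MG11.IsStationaryLaw P (MG11.aoi X S i)
        (volume.withDensity fun x => ENNReal.ofReal (f x)) ∧
      -- `f` is also the density of the inter-departure times
      (∀ k : ℕ, HasLaw (MG11.interDeparture X S i k)
        (volume.withDensity fun x => ENNReal.ofReal (f x)) P) := by
  have hprob := MG11.isProbabilityMeasure_interDepartureLaw (σ := σ) hrate i
  have hac := MG11.interDepartureLaw_absolutelyContinuous hrate hσ i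
  have hpos := MG11.ae_interDepartureLaw_pos hrate hσ i
  have hdens := MG11.withDensity_halfLineDensity hac hpos
  have hlap := MG11.isInverseLaplace_halfLineDensity hac hpos fun s hs =>
    MG11.integral_cexp_interDepartureLaw hrate hσ i hs
  have hviol : ∀ w : ℝ, 0 < w → MG11.IsViolationProbability P (MG11.aoi X S i) w
      ((MG11.interDepartureLaw rate σ i).real (Ioi w)) :=
    fun w hw => hXS.isViolationProbability_aoi hrate hσ i hw
  -- The witness is the Radon–Nikodym density of the law of the first departure, set to 0 on the
  -- negative half-line.
  refine ⟨MG11.halfLineDensity (MG11.interDepartureLaw rate σ i),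
    MG11.measurable_halfLineDensity _, MG11.halfLineDensity_nonneg _, hlap,
    fun g hg => hg.ae_eq hlap, fun w hw => ?_, ?_, fun k => ?_⟩
  · rw [MG11.one_sub_integral_halfLineDensity hac hpos hw.le]
    exact hviol w hw
  · rw [hdens]
    exact ⟨hprob, MG11.isViolationProbability_of_forall_pos hpos hviol⟩
  · rw [hdens]
    have hm := MG11.measurable_interDeparture i k
    refine ⟨(hm.comp hXS.measurable_data).aemeasurable, ?_⟩
    rw [← MG11.map_interDeparture hrate hσ i k, ← hXS.map_eq_dataLaw hrate,
      Measure.map_map hm hXS.measurable_data]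
    rfl
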